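/- All Hilbert spaces are finite-dimensional. For a Hilbert space $\mathcal H$ let $\mathcal D(\mathcal H)$ be the set of density operators (positive semidefinite, trace one), and let $\|X\|_1=\operatorname{Tr}\sqrt{X^\dagger X}$. For states $\rho,\sigma$ let $D(\rho\|\sigma)=\operatorname{Tr}\rho(\log\rho-\log\sigma)$ if $\operatorname{supp}\rho\subseteq\operatorname{supp}\sigma$, and $D(\rho\|\sigma)=+\infty$ otherwise. For a set $\mathcal F\subseteq\mathcal D(\mathcal H)$ put $$D_{\mathcal F}(\rho)=\inf_{\sigma\in\mathcal F}D(\rho\|\sigma),\qquad R_{\mathcal F}(\rho)=\inf\Big\{s\ge 0:\ \tfrac{1}{1+s}(\rho+s\sigma)\in\mathcal F\ \text{for some }\sigma\in\mathcal D(\mathcal H)\Big\}$$ (with $\inf\emptyset=+\infty$). A family of free states over $\mathcal H$ is a sequence $\mathcal M=(\mathcal M_n)_{n}$ of sets $\mathcal M_n\subseteq\mathcal D(\mathcal H^{\otimes n})$ satisfying Axioms 1–5: 1. each $\mathcal M_n$ is convex and closed; 2. each $\mathcal M_n$ contains a state of the form $\sigma^{\otimes n}$ with $\sigma\in\mathcal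 D(\mathcal H)$, $\sigma>0$; 3. if $\rho\in\mathcal M_{n+1}$, then $\operatorname{Tr}_{n+1}\rho\in\mathcal M_n$, where $\operatorname{Tr}_{n+1}$ is the partial trace over the last subsystem; 4. if $\rho\in\mathcal M_n$ and $\sigma\in\mathcal M_m$, then $\rho\otimes\sigma\in\mathcal M_{n+m}$; 5. if $\rho\in\mathcal M_n$ and $\pi\in S_n$, then $P_\pi\rho P_\pi^\dagger\in\mathcal M_n$, where $P_\pi$ is the unitary on $\mathcal H^{\otimes n}$ permuting the $n$ tensor factors by $\pi$. (For $n=0$, $\mathcal H^{\otimes 0}=\mathbb C$ and $\mathcal M_0=\{1\}$.) For such a family let $D^\infty_{\mathcal M}(\rho)=\lim_{n\to\infty}\frac1n D_{\mathcal M_n}(\rho^{\otimes n})$; by the axioms this limit exists and is finite for every state $\rho$. Let $A,A'$ be two (possibly different) systems with Hilbert spaces $\mathcal H_A,\mathcal H_{A'}$, and let $\mathcal M=(\mathcal M_n)_n$ and $\mathcal M'=(\mathcal M'_n)_n$ be families of free states over $\mathcal H_A$ and $\mathcal H_{A'}$, both satisfying Axioms 1–5. For $\delta\ge 0$ let $\mathrm{RNG}_\delta(A^n\to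 A'^k)$ be the set of completely positive trace-preserving maps $\Lambda$ from operators on $\mathcal H_A^{\otimes n}$ to operators on $\mathcal H_{A'}^{\otimes k}$ with $R_{\mathcal M'_k}(\Lambda(\sigma))\le\delta$ for all $\sigma\in\mathcal M_n$. For states $\rho\in\mathcal D(\mathcal H_A)$ and $\omega\in\mathcal D(\mathcal H_{A'})$ define $$R^{\mathrm{ARNG}}(\rho\to\omega)=\sup_{(k_n)_n,(\delta_n)_n}\Big\{\liminf_{n\to\infty}\frac{k_n}{n}:\ \lim_{n\to\infty}\ \inf_{\Lambda\in\mathrm{RNG}_{\delta_n}(A^n\to A'^{k_n})}\big\|\Lambda(\rho^{\otimes n})-\omega^{\otimes k_n}\big\|_1=0,\ \lim_{n\to\infty}\delta_n=0\Big\},$$ where the supremum is over sequences of non-negative integers $k_n$ and of real numbers $\delta_n\ge 0$. **Lemma.** If $D^\infty_{\mathcal M'}(\omega)>0$, then $$R^{\mathrm{ARNG}}(\rho\to\omega)\ \le\ \frac{D^\infty_{\mathcal M}(\rho)}{D^\infty_{\mathcal M'}(\omega)} .$$ -/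

import Mathlib

open Filter Topology
open scoped NNReal ENNReal Matrix Kronecker ComplexOrder

noncomputable section

namespace QRT

/-! ### States, tensor powers, entropies -/

section States

variable {ι κ : Type*} [Fintype ι] [DecidableEq ι] [Fintype κ] [DecidableEq κ]

/-- The set of density operators on the Hilbert space `ℂ^ι`: positive semidefinite with unit
trace. -/
def states (ι : Type*) [Fintype ι] : Set (Matrix ι ι ℂ) :=
  {ρ | ρ.PosSemidef ∧ ρ.trace = 1}

/-- The trace norm `‖X‖₁ = Tr √(X† X)`. -/
def traceNorm (X : Matrix ι ι ℂ) : ℝ :=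
  (cfc Real.sqrt (Xᴴ * X)).trace.re

/-- The Umegaki relative entropy `D(ρ‖σ) = Tr ρ (log ρ - log σ)` if `supp ρ ⊆ supp σ`, and `+∞`
otherwise. The support of a Hermitian operator is its range; the logarithm is taken on the support,
since `Real.log 0 = 0`. -/
def relEntropy (ρ σ : Matrix ι ι ℂ) : EReal :=
  open Classical in
  if LinearMap.range ρ.mulVecLin ≤ LinearMap.range σ.mulVecLin then
    (((ρ * (cfc Real.log ρ - cfc Real.log σ)).trace.re : ℝ) : EReal)
  else ⊤

/-- The relative entropy of resource `D_F(ρ) = min_{σ ∈ F} D(ρ‖σ)` relative to a set `F` of free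
states. -/
def relEntropyOfResource (F : Set (Matrix ι ι ℂ)) (ρ : Matrix ι ι ℂ) : EReal :=
  ⨅ σ ∈ F, relEntropy ρ σ

/-- The generalised robustness
`R_F(ρ) = min {s ≥ 0 : (ρ + s σ) / (1 + s) ∈ F for some state σ}`, with value `∞` when no such
`s` exists. -/
def robustness (F : Set (Matrix ι ι ℂ)) (ρ : Matrix ι ι ℂ) : ℝ≥0∞ :=
  ⨅ s ∈ {s : ℝ≥0 | ∃ σ ∈ states ι, (1 + (s : ℝ))⁻¹ • (ρ + (s : ℝ) • σ) ∈ F}, (s : ℝ≥0∞)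

end States

/-! ### Quantum channels -/

section Channels

variable {ι κ : Type*} [Fintype ι] [DecidableEq ι] [Fintype κ] [DecidableEq κ]

/-- `Λ` is completely positive and trace preserving. Complete positivity is Mathlib's notion, for
the C⋆-algebras of square matrices with the operator norm and the positive semidefinite order. -/
def IsCPTP (Λ : Matrix ι ι ℂ →ₗ[ℂ] Matrix κ κ ℂ) : Prop :=
  open scoped Matrix.Norms.L2Operator MatrixOrder in
  (∃ Φ : CompletelyPositiveMap (Matrix ι ι ℂ) (Matrix κ κ ℂ), Φ.toLinearMap = Λ) ∧
    ∀ X, (Λ X).trace = X.trace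

/-- The `δ`-resource-non-generating operations from a system with free states `F` to a system with
free states `F'`. -/
def RNG (F : Set (Matrix ι ι ℂ)) (F' : Set (Matrix κ κ ℂ)) (δ : ℝ≥0) :
    Set (Matrix ι ι ℂ →ₗ[ℂ] Matrix κ κ ℂ) :=
  {Λ | IsCPTP Λ ∧ ∀ σ ∈ F, robustness F' (Λ σ) ≤ δ}

end Channels

/-! ### Many copies of a system: `(ℂ^A)^{⊗n}` is `ℂ^(Fin n → A)` -/

section Copies

variable {A B : Type*} [Fintype A] [DecidableEq A] [Fintype B] [DecidableEq B]

/-- Operators on `(ℂ^A)^{⊗n}`. -/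
abbrev Op (A : Type*) (n : ℕ) : Type _ := Matrix (Fin n → A) (Fin n → A) ℂ

/-- The tensor power `ρ^{⊗n}`. -/
def tensorPow (ρ : Matrix A A ℂ) (n : ℕ) : Op A n :=
  Matrix.of fun i j => ∏ l, ρ (i l) (j l)

/-- The tensor product of an operator on the first `n` and one on the last `m` subsystems. -/
def tensor {n m : ℕ} (X : Op A n) (Y : Op A m) : Op A (n + m) :=
  (X ⊗ₖ Y).reindex (Fin.appendEquiv n m) (Fin.appendEquiv n m)

/-- The partial trace over the last of `n + 1` subsystems. -/
def partialTraceLast {n : ℕ} (X : Op A (n + 1)) : Op A n :=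
  Matrix.of fun i j => ∑ a, X (Fin.snoc i a) (Fin.snoc j a)

/-- The unitary `P_π` that permutes the `n` subsystems: it sends the basis vector
`e_{i 0} ⊗ ⋯ ⊗ e_{i (n-1)}` to the one indexed by `i ∘ π⁻¹`. -/
def permUnitary {n : ℕ} (π : Equiv.Perm (Fin n)) : Op A n :=
  Matrix.of fun i j => if i = j ∘ π.symm then 1 else 0

/-- Axioms 1-5 for a family `M n` of sets of free states on `(ℂ^A)^{⊗n}`. (For `n = 0` they just say
that `M 0` consists of the only state on `ℂ`.) -/
structure IsFreeFamily (M : ∀ n : ℕ, Set (Op A n)) : Prop where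
  subset_states : ∀ n, M n ⊆ states (Fin n → A)
  convex : ∀ n, Convex ℝ (M n)
  closed : ∀ n, IsClosed (M n)
  exists_fullRank : ∀ n, ∃ σ ∈ states A, σ.PosDef ∧ tensorPow σ n ∈ M n
  partialTrace_mem : ∀ n, ∀ ρ ∈ M (n + 1), partialTraceLast ρ ∈ M n
  tensor_mem : ∀ n m, ∀ ρ ∈ M n, ∀ σ ∈ M m, tensor ρ σ ∈ M (n + m)
  perm_mem : ∀ n, ∀ π : Equiv.Perm (Fin n), ∀ ρ ∈ M n,
    permUnitary π * ρ * (permUnitary π)ᴴ ∈ M n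

/-- The regularised relative entropy of resource
`D_M^∞(ρ) = lim_{n → ∞} D_{M_n}(ρ^{⊗n}) / n`. -/
def regRelEntropy (M : ∀ n : ℕ, Set (Op A n)) (ρ : Matrix A A ℂ) : EReal :=
  limUnder atTop fun n : ℕ => relEntropyOfResource (M n) (tensorPow ρ n) / (n : EReal)

/-- The optimal error `min_Λ ‖Λ(ρ^{⊗n}) - ω^{⊗k}‖₁` over the `δ`-resource-non-generating `Λ`. -/
def conversionError (M : ∀ n : ℕ, Set (Op A n)) (M' : ∀ n : ℕ, Set (Op B n))
    (ρ : Matrix A A ℂ) (ω : Matrix B B ℂ) (n k : ℕ) (δ : ℝ≥0) : ℝ≥0∞ :=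
  ⨅ Λ ∈ RNG (M n) (M' k) δ, ENNReal.ofReal (traceNorm (Λ (tensorPow ρ n) - tensorPow ω k))

/-- The asymptotic transformation rate `R^ARNG(ρ → ω)` under asymptotically resource non-generating
operations. -/
def rateARNG (M : ∀ n : ℕ, Set (Op A n)) (M' : ∀ n : ℕ, Set (Op B n))
    (ρ : Matrix A A ℂ) (ω : Matrix B B ℂ) : EReal :=
  sSup {r | ∃ (k : ℕ → ℕ) (δ : ℕ → ℝ≥0),
    Tendsto (fun n => conversionError M M' ρ ω n (k n) (δ n)) atTop (𝓝 0) ∧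
    Tendsto δ atTop (𝓝 0) ∧
    r = liminf (fun n => (((k n : ℝ) / (n : ℝ) : ℝ) : EReal)) atTop}

end Copies

end QRT

end

/-! Suppose approximately non-generating channels carry `ρ^{⊗n}` to within `ε` of `ω^{⊗k}`, and
write `D` for the relative entropy of resource. Then `k · D^∞(ω) ≤ D(ω^{⊗k}) ≤ D(Λ(ρ^{⊗n})) + k ε
log(1/c) + 2 ≤ D(ρ^{⊗n}) + k ε log(1/c) + 4`. Dividing by `n`, letting `n → ∞` and then `ε → 0`
gives the bound.

The first inequality is Fekete's lemma: `D` is subadditive on tensor powers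
(`IsFreeFamily.subadditive`), so its regularisation is an infimum. The second is asymptotic
continuity (`resourceDiv_le_add`). Its error is only linear in `k` because the free set contains a
state above `c ^ k • 1` (`IsFreeFamily.exists_smul_one_le`). The third (`resourceDiv_map_le`)
combines data processing with the fact that bounded robustness puts `Λ σ` below `1 + s` times a free
state, at a cost of `log (1 + s)`.

The inequalities for the relative entropy itself rest on one integral formula: up to the divergent
term `Tr ρ · log T`, it is the integral over `0 < t < T` of `resolventEntropy ρ σ t`, a maximum over
`X` of forms that are linear in `(ρ, σ)`. Data processing, joint convexity and antitonicity in `σ`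
are checked form by form at each `t`, and `umegaki_le_add` transfers them. -/

set_option linter.unusedSectionVars false

noncomputable section

namespace QRT

open Matrix

/-! ### Diagonalizations and the functional calculus -/

section Diagonalization

variable {ι κ : Type*} [Fintype ι] [DecidableEq ι] [Fintype κ] [DecidableEq κ]

/-- The unitary `U` diagonalizes `A`, with real eigenvalues `p`. -/
structure IsDiagonalization (U : Matrix ι ι ℂ) (p : ι → ℝ) (A : Matrix ι ι ℂ) : Prop where
  unitary : Uᴴ * U = 1
  eq : A = U * diagonal (fun i => (p i : ℂ)) * Uᴴ

theorem exists_isDiagonalization {A : Matrix ι ι ℂ} (hA : A.IsHermitian) :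
    ∃ U p, IsDiagonalization U p A := by
  refine ⟨hA.eigenvectorUnitary, hA.eigenvalues, ?_, ?_⟩
  · exact Unitary.coe_star_mul_self hA.eigenvectorUnitary
  · conv_lhs => rw [hA.spectral_theorem]
    rw [Unitary.conjStarAlgAut_apply]
    rfl

namespace IsDiagonalization

variable {U : Matrix ι ι ℂ} {p : ι → ℝ} {A : Matrix ι ι ℂ}

theorem unitary' (h : IsDiagonalization U p A) : U * Uᴴ = 1 :=
  mul_eq_one_comm.mp h.unitary

theorem isHermitian (h : IsDiagonalization U p A) : A.IsHermitian := by
  have : (diagonal (fun i => (p i : ℂ))).IsHermitian := by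
    rw [IsHermitian, diagonal_conjTranspose]
    congr 1
    ext i
    simp
  rw [h.eq]
  exact isHermitian_mul_mul_conjTranspose U this

theorem conj_eq (h : IsDiagonalization U p A) : Uᴴ * A * U = diagonal (fun i => (p i : ℂ)) := by
  rw [h.eq]
  calc _ = (Uᴴ * U) * diagonal (fun i => (p i : ℂ)) * (Uᴴ * U) := by simp only [Matrix.mul_assoc]
    _ = _ := by rw [h.unitary, Matrix.one_mul, Matrix.mul_one]

theorem nonneg (h : IsDiagonalization U p A) (hA : A.PosSemidef) (i : ι) : 0 ≤ p i := by
  have := hA.conjTranspose_mul_mul_same U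
  rw [h.conj_eq, posSemidef_diagonal_iff] at this
  exact_mod_cast this i

theorem posSemidef (h : IsDiagonalization U p A) (hp : ∀ i, 0 ≤ p i) : A.PosSemidef := by
  rw [h.eq]
  refine PosSemidef.mul_mul_conjTranspose_same (posSemidef_diagonal_iff.mpr fun i => ?_) U
  exact_mod_cast hp i

/-- The functional calculus acts on the eigenvalues of any diagonalization. -/
theorem cfc_eq (h : IsDiagonalization U p A) (f : ℝ → ℝ) :
    cfc f A = U * diagonal (fun i => (f (p i) : ℂ)) * Uᴴ := by
  have hA := h.isHermitian
  rw [hA.cfc_eq, IsHermitian.cfc, Unitary.conjStarAlgAut_apply]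
  set E : Matrix ι ι ℂ := (hA.eigenvectorUnitary : Matrix ι ι ℂ) with hE
  have hEu : Eᴴ * E = 1 := Unitary.coe_star_mul_self hA.eigenvectorUnitary
  have hEu' : E * Eᴴ = 1 := mul_eq_one_comm.mp hEu
  have hAE : A = E * diagonal (fun i => (hA.eigenvalues i : ℂ)) * Eᴴ := by
    conv_lhs => rw [hA.spectral_theorem]
    rw [Unitary.conjStarAlgAut_apply]
    rfl
  set T := Eᴴ * U with hT
  have h1 : diagonal (fun i => (hA.eigenvalues i : ℂ)) * T = T * diagonal (fun i => (p i : ℂ)) := by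
    calc diagonal (fun i => (hA.eigenvalues i : ℂ)) * T
        = (Eᴴ * E) * diagonal (fun i => (hA.eigenvalues i : ℂ)) * Eᴴ * U := by
          rw [hEu, Matrix.one_mul, hT, Matrix.mul_assoc]
      _ = Eᴴ * (E * diagonal (fun i => (hA.eigenvalues i : ℂ)) * Eᴴ) * U := by
          simp only [Matrix.mul_assoc]
      _ = Eᴴ * (U * diagonal (fun i => (p i : ℂ)) * Uᴴ) * U := by rw [← hAE, ← h.eq]
      _ = Eᴴ * U * diagonal (fun i => (p i : ℂ)) * (Uᴴ * U) := by simp only [Matrix.mul_assoc]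
      _ = T * diagonal (fun i => (p i : ℂ)) := by rw [h.unitary, Matrix.mul_one]
  -- `T` intertwines the two spectra, so it vanishes off the pairs of equal eigenvalues and
  -- therefore also intertwines their images under `f`.
  have h2 : diagonal (fun i => (f (hA.eigenvalues i) : ℂ)) * T
      = T * diagonal (fun i => (f (p i) : ℂ)) := by
    ext i j
    have h3 := congrFun (congrFun h1 i) j
    rw [diagonal_mul, mul_diagonal] at h3 ⊢
    by_cases h4 : T i j = 0
    · simp [h4]
    · have : hA.eigenvalues i = p j := by
        rw [mul_comm] at h3
        exact_mod_cast mul_left_cancel₀ h4 h3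
      rw [this, mul_comm]
  change E * diagonal (fun i => (f (hA.eigenvalues i) : ℂ)) * Eᴴ = _
  calc E * diagonal (fun i => (f (hA.eigenvalues i) : ℂ)) * Eᴴ
      = E * (diagonal (fun i => (f (hA.eigenvalues i) : ℂ)) * T) * Uᴴ := by
        rw [hT]
        simp only [Matrix.mul_assoc]
        rw [h.unitary', Matrix.mul_one]
    _ = (E * Eᴴ) * U * diagonal (fun i => (f (p i) : ℂ)) * Uᴴ := by
        rw [h2, hT]
        simp only [Matrix.mul_assoc]
    _ = _ := by rw [hEu', Matrix.one_mul]

theorem kronecker {V : Matrix κ κ ℂ} {q : κ → ℝ} {B : Matrix κ κ ℂ}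
    (h : IsDiagonalization U p A) (h' : IsDiagonalization V q B) :
    IsDiagonalization (U ⊗ₖ V) (fun x => p x.1 * q x.2) (A ⊗ₖ B) where
  unitary := by
    rw [conjTranspose_kronecker, ← mul_kronecker_mul, h.unitary, h'.unitary, one_kronecker_one]
  eq := by
    conv_lhs => rw [h.eq, h'.eq]
    rw [conjTranspose_kronecker, mul_kronecker_mul, mul_kronecker_mul,
      diagonal_kronecker_diagonal]
    simp

theorem reindex (h : IsDiagonalization U p A) (e : ι ≃ κ) :
    IsDiagonalization (U.reindex e e) (fun x => p (e.symm x)) (A.reindex e e) where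
  unitary := by
    simp only [reindex_apply, conjTranspose_submatrix, submatrix_mul_equiv, h.unitary,
      submatrix_one_equiv]
  eq := by
    conv_lhs => rw [h.eq]
    have : diagonal (fun x => (p (e.symm x) : ℂ))
        = (diagonal (fun i => (p i : ℂ))).submatrix e.symm e.symm := by
      rw [submatrix_diagonal_equiv]
      rfl
    rw [this]
    simp only [reindex_apply, conjTranspose_submatrix, submatrix_mul_equiv]

theorem trace_mul (h : IsDiagonalization U p A) (X : Matrix ι ι ℂ) :
    (A * X).trace = ∑ i, (p i : ℂ) * (Uᴴ * X * U) i i := by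
  have : (A * X).trace = (diagonal (fun i => (p i : ℂ)) * (Uᴴ * X * U)).trace := by
    rw [h.eq, Matrix.mul_assoc, Matrix.mul_assoc, trace_mul_comm]
    simp only [Matrix.mul_assoc]
  rw [this, trace]
  simp [diagonal_mul]

theorem trace_eq (h : IsDiagonalization U p A) : A.trace.re = ∑ i, p i := by
  have := h.trace_mul 1
  rw [Matrix.mul_one, Matrix.mul_one, h.unitary] at this
  simp [this]

end IsDiagonalization

end Diagonalization

/-! ### Domination of positive semidefinite matrices -/

section Domination

variable {ι κ : Type*} [Fintype ι] [DecidableEq ι] [Fintype κ] [DecidableEq κ]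

/-- Some real multiple of `σ` is an upper bound of `ρ`. -/
def Dominated (ρ σ : Matrix ι ι ℂ) : Prop := ∃ c : ℝ, (c • σ - ρ).PosSemidef

theorem PosSemidef.real_smul {A : Matrix ι ι ℂ} (hA : A.PosSemidef) {c : ℝ} (hc : 0 ≤ c) :
    (c • A).PosSemidef := by
  exact hA.smul hc

theorem exists_eq_conjTranspose_mul_self {A : Matrix ι ι ℂ} (hA : A.PosSemidef) :
    ∃ B, A = Bᴴ * B := by
  open scoped Matrix.Norms.L2Operator MatrixOrder in
  exact CStarAlgebra.nonneg_iff_eq_star_mul_self.mp hA.nonneg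

theorem re_trace_nonneg {A : Matrix ι ι ℂ} (hA : A.PosSemidef) : 0 ≤ A.trace.re :=
  (Complex.le_def.mp hA.trace_nonneg).1

theorem eq_zero_of_re_trace_nonpos {A : Matrix ι ι ℂ} (hA : A.PosSemidef) (h : A.trace.re ≤ 0) :
    A = 0 := by
  obtain ⟨B, rfl⟩ := exists_eq_conjTranspose_mul_self hA
  have h1 := Complex.le_def.mp hA.trace_nonneg
  have h2 : (Bᴴ * B).trace = 0 := Complex.ext (le_antisymm h h1.1) h1.2.symm
  rw [trace_conjTranspose_mul_self_eq_zero_iff.mp h2, Matrix.mul_zero]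

theorem posSemidef_trace_smul_one_sub {A : Matrix ι ι ℂ} (hA : A.PosSemidef) :
    (A.trace.re • (1 : Matrix ι ι ℂ) - A).PosSemidef := by
  obtain ⟨U, p, h⟩ := exists_isDiagonalization hA.isHermitian
  have hU : IsDiagonalization U (fun i => A.trace.re - p i) (A.trace.re • (1 : Matrix ι ι ℂ) - A) :=
    { unitary := h.unitary
      eq := by
        have : diagonal (fun i => ((A.trace.re - p i : ℝ) : ℂ))
            = A.trace.re • (1 : Matrix ι ι ℂ) - diagonal (fun i => (p i : ℂ)) := by
          ext i j
          by_cases hij : i = j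
          · subst hij; simp
          · simp [hij]
        rw [this, Matrix.mul_sub, Matrix.sub_mul, ← h.eq]
        simp [h.unitary'] }
  refine hU.posSemidef fun i => ?_
  rw [h.trace_eq, sub_nonneg]
  exact Finset.single_le_sum (fun j _ => h.nonneg hA j) (Finset.mem_univ i)

/-- For positive semidefinite matrices, inclusion of supports is domination. -/
theorem range_le_range_iff_dominated {ρ σ : Matrix ι ι ℂ} (hρ : ρ.PosSemidef)
    (hσ : σ.PosSemidef) :
    LinearMap.range ρ.mulVecLin ≤ LinearMap.range σ.mulVecLin ↔ Dominated ρ σ := by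
  obtain ⟨V, q, h⟩ := exists_isDiagonalization hσ.isHermitian
  have hq := h.nonneg hσ
  -- As `0⁻¹ = 0`, `R` is the pseudo-inverse of `σ`; `P = σ * R` is the projection onto the range of
  -- `σ`.
  set R := V * diagonal (fun i => ((q i)⁻¹ : ℂ)) * Vᴴ with hR
  set P := V * diagonal (fun i => (if q i = 0 then 0 else 1 : ℂ)) * Vᴴ with hP
  have conj_mul : ∀ d e : ι → ℂ, (V * diagonal d * Vᴴ) * (V * diagonal e * Vᴴ)
      = V * diagonal (fun i => d i * e i) * Vᴴ := by
    intro d e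
    calc _ = V * diagonal d * (Vᴴ * V) * diagonal e * Vᴴ := by simp only [Matrix.mul_assoc]
      _ = _ := by
        rw [h.unitary, Matrix.mul_one, Matrix.mul_assoc V, diagonal_mul_diagonal]
  have hPσ : P * σ = σ := by
    rw [hP]
    conv_lhs => rw [h.eq]
    conv_rhs => rw [h.eq]
    rw [conj_mul]
    congr! 3
    ext i
    by_cases hi : q i = 0 <;> simp [hi]
  have hPσR : P = σ * R := by
    rw [hP, hR]
    conv_rhs => rw [h.eq]
    rw [conj_mul]
    congr! 3
    ext i
    by_cases hi : q i = 0 <;> simp [hi]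
  have hPP : P * P = P := by
    rw [hP, conj_mul]
    congr! 3
    ext i
    by_cases hi : q i = 0 <;> simp [hi]
  have hPh : Pᴴ = P := by
    rw [hP]
    simp only [conjTranspose_mul, conjTranspose_conjTranspose, diagonal_conjTranspose,
      Matrix.mul_assoc]
    congr! 3
    ext i
    by_cases hi : q i = 0 <;> simp [hi]
  constructor
  · intro hle
    have hPρ : P * ρ = ρ := by
      refine Matrix.ext_of_mulVec_single fun i => ?_
      obtain ⟨w, hw⟩ := hle ⟨Pi.single i 1, rfl⟩
      simp only [mulVecLin_apply] at hw
      rw [← mulVec_mulVec, ← hw, mulVec_mulVec, hPσ]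
    have hρP : ρ * P = ρ := by
      have := congrArg conjTranspose hPρ
      rwa [conjTranspose_mul, hPh, hρ.isHermitian.eq] at this
    -- Compressing `ρ ≤ Tr ρ · 1` by `P` gives `ρ ≤ Tr ρ · P`; and `P ≤ c • σ` once `c` exceeds
    -- every inverse nonzero eigenvalue.
    have h1 := (posSemidef_trace_smul_one_sub hρ).conjTranspose_mul_mul_same P
    have h2 : Pᴴ * (ρ.trace.re • (1 : Matrix ι ι ℂ) - ρ) * P = ρ.trace.re • P - ρ := by
      rw [hPh, Matrix.mul_sub, Matrix.sub_mul, hPρ, hρP]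
      simp [hPP]
    rw [h2] at h1
    set c := ∑ j, (q j)⁻¹ with hc
    have h3 : (c • σ - P).PosSemidef := by
      have : IsDiagonalization V (fun i => c * q i - if q i = 0 then 0 else 1) (c • σ - P) :=
        { unitary := h.unitary
          eq := by
            have : diagonal (fun i => ((c * q i - if q i = 0 then 0 else 1 : ℝ) : ℂ))
                = c • diagonal (fun i => (q i : ℂ))
                  - diagonal (fun i => (if q i = 0 then 0 else 1 : ℂ)) := by
              ext i j
              by_cases hij : i = j
              · subst hij; by_cases hi : q i = 0 <;> simp [hi]
              · simp [hij]
            rw [this, Matrix.mul_sub, Matrix.sub_mul, ← hP]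
            conv_lhs => rw [h.eq]
            simp }
      refine this.posSemidef fun i => ?_
      by_cases hi : q i = 0
      · simp [hi]
      · have h4 : (q i)⁻¹ ≤ c := Finset.single_le_sum (f := fun j => (q j)⁻¹)
          (fun j _ => inv_nonneg.mpr (hq j)) (Finset.mem_univ i)
        have h5 : (q i)⁻¹ * q i ≤ c * q i := mul_le_mul_of_nonneg_right h4 (hq i)
        rw [inv_mul_cancel₀ hi] at h5
        simpa [hi] using h5
    refine ⟨ρ.trace.re * c, ?_⟩
    have h6 := h1.add (PosSemidef.real_smul h3 (re_trace_nonneg hρ))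
    convert h6 using 1
    rw [smul_sub, smul_smul]
    abel
  · rintro ⟨c, hc⟩
    -- Compression by `1 - P` kills `σ`, so domination leaves minus the compression of `ρ` positive;
    -- hence `ρ` lives on `P`, whose range is that of `σ`.
    have hQ : σ * (1 - P) = 0 := by
      have := congrArg conjTranspose hPσ
      rw [conjTranspose_mul, hPh, hσ.isHermitian.eq] at this
      rw [Matrix.mul_sub, this, Matrix.mul_one, sub_self]
    have h1 := hρ.conjTranspose_mul_mul_same (1 - P)
    have h2 := hc.conjTranspose_mul_mul_same (1 - P)
    have h3 : (1 - P)ᴴ * (c • σ - ρ) * (1 - P) = -((1 - P)ᴴ * ρ * (1 - P)) := by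
      rw [Matrix.mul_sub _ (c • σ), Matrix.sub_mul]
      simp only [Matrix.mul_assoc, Matrix.smul_mul, hQ, smul_zero, Matrix.mul_zero, zero_sub]
    rw [h3] at h2
    have h4 := re_trace_nonneg h2
    rw [trace_neg, Complex.neg_re, Left.nonneg_neg_iff] at h4
    have h5 := eq_zero_of_re_trace_nonpos h1 h4
    obtain ⟨B, rfl⟩ := exists_eq_conjTranspose_mul_self hρ
    have h6 : B * (1 - P) = 0 := by
      rw [← conjTranspose_mul_self_eq_zero, conjTranspose_mul, ← h5]
      simp only [Matrix.mul_assoc]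
    have h7 : (Bᴴ * B) * P = Bᴴ * B := by
      have : B * P = B := by
        rw [Matrix.mul_sub, Matrix.mul_one, sub_eq_zero] at h6
        exact h6.symm
      rw [Matrix.mul_assoc, this]
    have h8 : P * (Bᴴ * B) = Bᴴ * B := by
      have := congrArg conjTranspose h7
      rwa [conjTranspose_mul, hPh, hρ.isHermitian.eq] at this
    rintro _ ⟨v, rfl⟩
    refine ⟨(R * (Bᴴ * B)) *ᵥ v, ?_⟩
    rw [mulVecLin_apply, mulVecLin_apply, mulVec_mulVec, ← Matrix.mul_assoc, ← hPσR, h8]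

end Domination

/-! ### The relative entropy in terms of eigenvalues -/

section Umegaki

variable {ι κ : Type*} [Fintype ι] [DecidableEq ι] [Fintype κ] [DecidableEq κ]

/-- The squared moduli of the overlaps between the columns of `U` and of `V`. -/
def overlap (U V : Matrix ι ι ℂ) (i j : ι) : ℝ := Complex.normSq ((Uᴴ * V) i j)

theorem overlap_nonneg (U V : Matrix ι ι ℂ) (i j : ι) : 0 ≤ overlap U V i j :=
  Complex.normSq_nonneg _

theorem overlap_symm (U V : Matrix ι ι ℂ) (i j : ι) : overlap U V i j = overlap V U j i := by
  have : Vᴴ * U = (Uᴴ * V)ᴴ := by simp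
  rw [overlap, overlap, this, conjTranspose_apply]
  exact (Complex.normSq_conj _).symm

theorem conj_diagonal_conj_apply (U V : Matrix ι ι ℂ) (d : ι → ℝ) (i : ι) :
    (Uᴴ * (V * diagonal (fun j => (d j : ℂ)) * Vᴴ) * U) i i
      = ((∑ j, d j * overlap U V i j : ℝ) : ℂ) := by
  have : Uᴴ * (V * diagonal (fun j => (d j : ℂ)) * Vᴴ) * U
      = (Uᴴ * V) * diagonal (fun j => (d j : ℂ)) * (Uᴴ * V)ᴴ := by
    simp [Matrix.mul_assoc]
  rw [this, mul_apply]
  push_cast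
  refine Finset.sum_congr rfl fun j _ => ?_
  rw [mul_diagonal, conjTranspose_apply, overlap, ← Complex.mul_conj]
  simp only [RCLike.star_def]
  ring

theorem sum_overlap {U V : Matrix ι ι ℂ} (hU : Uᴴ * U = 1) (hV : Vᴴ * V = 1) (i : ι) :
    ∑ j, overlap U V i j = 1 := by
  have h := conj_diagonal_conj_apply U V (fun _ => 1) i
  have h1 : (diagonal fun _ : ι => ((1 : ℝ) : ℂ)) = 1 := by simp
  rw [h1, Matrix.mul_one, mul_eq_one_comm.mp hV, Matrix.mul_one, hU, one_apply_eq] at h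
  simp only [one_mul] at h
  exact_mod_cast h.symm

theorem overlap_self {U : Matrix ι ι ℂ} (hU : Uᴴ * U = 1) (i j : ι) :
    overlap U U i j = if i = j then 1 else 0 := by
  rw [overlap, hU, one_apply]
  split_ifs <;> simp

theorem IsDiagonalization.re_trace_mul_cfc {U V ρ σ : Matrix ι ι ℂ} {p q : ι → ℝ}
    (hρ : IsDiagonalization U p ρ) (hσ : IsDiagonalization V q σ) (f : ℝ → ℝ) :
    (ρ * cfc f σ).trace.re = ∑ i, ∑ j, overlap U V i j * p i * f (q j) := by
  rw [hρ.trace_mul, hσ.cfc_eq]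
  simp only [conj_diagonal_conj_apply U V (fun j => f (q j)), ← Complex.ofReal_mul,
    ← Complex.ofReal_sum, Complex.ofReal_re]
  refine Finset.sum_congr rfl fun i _ => ?_
  rw [Finset.mul_sum]
  exact Finset.sum_congr rfl fun j _ => by ring

/-- The real number `Tr ρ (log ρ - log σ)`. -/
def umegaki (ρ σ : Matrix ι ι ℂ) : ℝ := (ρ * (cfc Real.log ρ - cfc Real.log σ)).trace.re

theorem umegaki_eq_sub (ρ σ : Matrix ι ι ℂ) :
    umegaki ρ σ = (ρ * cfc Real.log ρ).trace.re - (ρ * cfc Real.log σ).trace.re := by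
  rw [umegaki, Matrix.mul_sub, trace_sub, Complex.sub_re]

theorem relEntropy_of_dominated {ρ σ : Matrix ι ι ℂ} (hρ : ρ.PosSemidef) (hσ : σ.PosSemidef)
    (h : Dominated ρ σ) : relEntropy ρ σ = (umegaki ρ σ : EReal) := by
  rw [relEntropy, if_pos ((range_le_range_iff_dominated hρ hσ).mpr h), umegaki]

theorem relEntropy_of_not_dominated {ρ σ : Matrix ι ι ℂ} (hρ : ρ.PosSemidef) (hσ : σ.PosSemidef)
    (h : ¬ Dominated ρ σ) : relEntropy ρ σ = ⊤ := by
  rw [relEntropy, if_neg fun h' => h ((range_le_range_iff_dominated hρ hσ).mp h')]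

/-- The Nussbaum–Szkoła form: a classical divergence between the weights `overlap * p i` and
`overlap * q j` on pairs `(i, j)`. -/
theorem IsDiagonalization.umegaki_eq {U V ρ σ : Matrix ι ι ℂ} {p q : ι → ℝ}
    (hρ : IsDiagonalization U p ρ) (hσ : IsDiagonalization V q σ) :
    umegaki ρ σ = ∑ i, ∑ j, overlap U V i j * p i * (Real.log (p i) - Real.log (q j)) := by
  have h1 : (ρ * cfc Real.log ρ).trace.re
      = ∑ i, ∑ j, overlap U V i j * p i * Real.log (p i) := by
    rw [hρ.re_trace_mul_cfc hρ]
    refine Finset.sum_congr rfl fun i _ => ?_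
    simp only [overlap_self hρ.unitary, ← Finset.sum_mul, sum_overlap hρ.unitary hσ.unitary]
    simp
  rw [umegaki_eq_sub, h1, hρ.re_trace_mul_cfc hσ]
  simp only [mul_sub, Finset.sum_sub_distrib]

/-- Absolute continuity of these weights: domination makes the expectation of `ρ` in a null
eigenvector of `σ` nonpositive, yet it is a sum of nonnegative terms. This makes the convention
`Real.log 0 = 0` harmless. -/
theorem IsDiagonalization.overlap_mul_eq_zero {U V ρ σ : Matrix ι ι ℂ} {p q : ι → ℝ}
    (hρ : IsDiagonalization U p ρ) (hσ : IsDiagonalization V q σ) (hp : ∀ i, 0 ≤ p i)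
    (hd : Dominated ρ σ) (i j : ι) (hj : q j = 0) : overlap U V i j * p i = 0 := by
  obtain ⟨c, hc⟩ := hd
  have h1 : 0 ≤ (Vᴴ * (c • σ - ρ) * V) j j := (hc.conjTranspose_mul_mul_same V).diag_nonneg
  rw [Matrix.mul_sub, Matrix.sub_mul, Matrix.mul_smul, Matrix.smul_mul, hσ.conj_eq, Matrix.sub_apply,
    Matrix.smul_apply, diagonal_apply_eq, hj, hρ.eq, conj_diagonal_conj_apply] at h1
  simp only [Complex.ofReal_zero, smul_zero, zero_sub, Left.nonneg_neg_iff] at h1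
  have h2 : ∑ i, p i * overlap V U j i ≤ 0 := by exact_mod_cast h1
  have h3 := (Finset.sum_eq_zero_iff_of_nonneg
    fun i _ => mul_nonneg (hp i) (overlap_nonneg V U j i)).mp
      (le_antisymm h2 (Finset.sum_nonneg fun i _ => mul_nonneg (hp i) (overlap_nonneg V U j i)))
  rw [overlap_symm, mul_comm]
  exact h3 i (Finset.mem_univ i)

end Umegaki

/-! ### An integral formula for the relative entropy -/

section Resolvent

variable {ι κ : Type*} [Fintype ι] [DecidableEq ι] [Fintype κ] [DecidableEq κ]

/-- The quadratic form whose maximum over `X` is `⟨ρ, (L_σ + t R_ρ)⁻¹ ρ⟩`, where `L_σ` and `R_ρ`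
are left and right multiplication. -/
def resolventForm (ρ σ : Matrix ι ι ℂ) (t : ℝ) (X : Matrix ι ι ℂ) : ℝ :=
  2 * (ρ * X).trace.re - (σ * (X * Xᴴ)).trace.re - t * (ρ * (Xᴴ * X)).trace.re

/-- The maximum of `resolventForm ρ σ t`. -/
def resolventEntropy (ρ σ : Matrix ι ι ℂ) (t : ℝ) : ℝ := ⨆ X, resolventForm ρ σ t X

/-- In the coordinates `Z = Vᴴ * X * U` the form decouples into one scalar quadratic per entry, so
it can be maximised entrywise. -/
theorem IsDiagonalization.resolventForm_eq {U V ρ σ : Matrix ι ι ℂ} {p q : ι → ℝ}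
    (hρ : IsDiagonalization U p ρ) (hσ : IsDiagonalization V q σ) (t : ℝ) (X : Matrix ι ι ℂ) :
    resolventForm ρ σ t X = ∑ i, ∑ j, (2 * p i * ((Uᴴ * V) i j * (Vᴴ * X * U) j i).re
      - (q j + t * p i) * Complex.normSq ((Vᴴ * X * U) j i)) := by
  set Z := Vᴴ * X * U with hZ
  have h1 : (ρ * X).trace.re = ∑ i, ∑ j, p i * ((Uᴴ * V) i j * Z j i).re := by
    have : Uᴴ * X * U = (Uᴴ * V) * Z := by
      calc Uᴴ * X * U = Uᴴ * (V * Vᴴ) * X * U := by rw [hσ.unitary', Matrix.mul_one]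
        _ = _ := by simp only [hZ, Matrix.mul_assoc]
    rw [hρ.trace_mul, this, Complex.re_sum]
    refine Finset.sum_congr rfl fun i _ => ?_
    rw [Complex.re_ofReal_mul, mul_apply, Complex.re_sum, Finset.mul_sum]
  have h2 : (σ * (X * Xᴴ)).trace.re = ∑ i, ∑ j, q j * Complex.normSq (Z j i) := by
    have : Vᴴ * (X * Xᴴ) * V = Z * Zᴴ := by
      calc Vᴴ * (X * Xᴴ) * V = Vᴴ * X * (U * Uᴴ) * Xᴴ * V := by
            rw [hρ.unitary', Matrix.mul_one]; simp only [Matrix.mul_assoc]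
        _ = _ := by
          simp only [hZ, conjTranspose_mul, conjTranspose_conjTranspose, Matrix.mul_assoc]
    rw [hσ.trace_mul, this, Complex.re_sum, Finset.sum_comm]
    refine Finset.sum_congr rfl fun j _ => ?_
    rw [Complex.re_ofReal_mul, mul_apply, Complex.re_sum, Finset.mul_sum]
    refine Finset.sum_congr rfl fun i _ => ?_
    rw [conjTranspose_apply, RCLike.star_def, Complex.mul_conj, Complex.ofReal_re]
  have h3 : (ρ * (Xᴴ * X)).trace.re = ∑ i, ∑ j, p i * Complex.normSq (Z j i) := by
    have : Uᴴ * (Xᴴ * X) * U = Zᴴ * Z := by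
      calc Uᴴ * (Xᴴ * X) * U = Uᴴ * Xᴴ * (V * Vᴴ) * X * U := by
            rw [hσ.unitary', Matrix.mul_one]; simp only [Matrix.mul_assoc]
        _ = _ := by
          simp only [hZ, conjTranspose_mul, conjTranspose_conjTranspose, Matrix.mul_assoc]
    rw [hρ.trace_mul, this, Complex.re_sum]
    refine Finset.sum_congr rfl fun i _ => ?_
    rw [Complex.re_ofReal_mul, mul_apply, Complex.re_sum, Finset.mul_sum]
    refine Finset.sum_congr rfl fun j _ => ?_
    rw [conjTranspose_apply, RCLike.star_def, mul_comm (starRingEnd ℂ _), Complex.mul_conj,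
      Complex.ofReal_re]
  rw [resolventForm, h1, h2, h3]
  simp only [Finset.mul_sum, ← Finset.sum_sub_distrib]
  refine Finset.sum_congr rfl fun i _ => Finset.sum_congr rfl fun j _ => ?_
  ring

theorem two_mul_re_sub_le {p a : ℝ} (ha : 0 ≤ a) (hp : a = 0 → p = 0) (w z : ℂ) :
    2 * p * (w * z).re - a * Complex.normSq z ≤ Complex.normSq w * p ^ 2 / a := by
  rcases ha.eq_or_lt with h | h
  · simp [← h, hp h.symm]
  · rw [le_div_iff₀ h, Complex.normSq_apply, Complex.normSq_apply, Complex.mul_re]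
    nlinarith [sq_nonneg (p * w.re - a * z.re), sq_nonneg (p * w.im + a * z.im)]

theorem IsDiagonalization.isGreatest_resolventForm {U V ρ σ : Matrix ι ι ℂ} {p q : ι → ℝ}
    (hρ : IsDiagonalization U p ρ) (hσ : IsDiagonalization V q σ) (hp : ∀ i, 0 ≤ p i)
    (hq : ∀ i, 0 ≤ q i) {t : ℝ} (ht : 0 < t) :
    IsGreatest (Set.range (resolventForm ρ σ t))
      (∑ i, ∑ j, overlap U V i j * p i ^ 2 / (q j + t * p i)) := by
  have ha : ∀ i j, 0 ≤ q j + t * p i := fun i j =>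
    add_nonneg (hq j) (mul_nonneg ht.le (hp i))
  have ha' : ∀ i j, q j + t * p i = 0 → p i = 0 := fun i j h => by
    have := mul_nonneg ht.le (hp i)
    have h2 : t * p i = 0 := le_antisymm (by linarith [hq j]) this
    exact (mul_eq_zero.mp h2).resolve_left ht.ne'
  constructor
  -- The entrywise maximiser, from completing the square; a zero denominator forces `p i = 0`, so `0
  -- / 0 = 0` is the right value there.
  · set Z : Matrix ι ι ℂ := of fun j i =>
      (starRingEnd ℂ) ((Uᴴ * V) i j) * ((p i / (q j + t * p i) : ℝ) : ℂ) with hZ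
    refine ⟨V * Z * Uᴴ, ?_⟩
    have : Vᴴ * (V * Z * Uᴴ) * U = Z := by
      calc Vᴴ * (V * Z * Uᴴ) * U = (Vᴴ * V) * Z * (Uᴴ * U) := by simp only [Matrix.mul_assoc]
        _ = Z := by rw [hρ.unitary, hσ.unitary, Matrix.one_mul, Matrix.mul_one]
    rw [hρ.resolventForm_eq hσ, this]
    refine Finset.sum_congr rfl fun i _ => Finset.sum_congr rfl fun j _ => ?_
    rw [hZ, of_apply, ← mul_assoc, Complex.mul_conj, ← Complex.ofReal_mul, Complex.ofReal_re,
      Complex.normSq_mul, Complex.normSq_conj, Complex.normSq_ofReal, overlap]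
    by_cases h : q j + t * p i = 0
    · simp [h]
    · field_simp
      ring
  · rintro _ ⟨X, rfl⟩
    rw [hρ.resolventForm_eq hσ]
    exact Finset.sum_le_sum fun i _ => Finset.sum_le_sum fun j _ =>
      two_mul_re_sub_le (ha i j) (ha' i j) _ _

theorem IsDiagonalization.resolventEntropy_eq {U V ρ σ : Matrix ι ι ℂ} {p q : ι → ℝ}
    (hρ : IsDiagonalization U p ρ) (hσ : IsDiagonalization V q σ) (hp : ∀ i, 0 ≤ p i)
    (hq : ∀ i, 0 ≤ q i) {t : ℝ} (ht : 0 < t) :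
    resolventEntropy ρ σ t = ∑ i, ∑ j, overlap U V i j * p i ^ 2 / (q j + t * p i) :=
  (hρ.isGreatest_resolventForm hσ hp hq ht).csSup_eq

theorem isGreatest_resolventEntropy {ρ σ : Matrix ι ι ℂ} (hρ : ρ.PosSemidef) (hσ : σ.PosSemidef)
    {t : ℝ} (ht : 0 < t) :
    IsGreatest (Set.range (resolventForm ρ σ t)) (resolventEntropy ρ σ t) := by
  obtain ⟨U, p, h⟩ := exists_isDiagonalization hρ.isHermitian
  obtain ⟨V, q, h'⟩ := exists_isDiagonalization hσ.isHermitian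
  have := h.isGreatest_resolventForm h' (h.nonneg hρ) (h'.nonneg hσ) ht
  rwa [← h.resolventEntropy_eq h' (h.nonneg hρ) (h'.nonneg hσ) ht] at this

theorem resolventForm_le_resolventEntropy {ρ σ : Matrix ι ι ℂ} (hρ : ρ.PosSemidef)
    (hσ : σ.PosSemidef) {t : ℝ} (ht : 0 < t) (X : Matrix ι ι ℂ) :
    resolventForm ρ σ t X ≤ resolventEntropy ρ σ t :=
  (isGreatest_resolventEntropy hρ hσ ht).2 ⟨X, rfl⟩

theorem resolventEntropy_le {ρ σ : Matrix ι ι ℂ} (hρ : ρ.PosSemidef) (hσ : σ.PosSemidef)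
    {t : ℝ} (ht : 0 < t) {b : ℝ} (hb : ∀ X, resolventForm ρ σ t X ≤ b) :
    resolventEntropy ρ σ t ≤ b := by
  obtain ⟨X, hX⟩ := (isGreatest_resolventEntropy hρ hσ ht).1
  exact hX ▸ hb X

/-! Integrals of the terms of the resolvent entropy. -/

theorem intervalIntegrable_and_integral_eq {w p q T : ℝ} (hp : 0 ≤ p) (hq : 0 ≤ q)
    (h : q = 0 → w * p = 0) (hT : 0 ≤ T) :
    IntervalIntegrable (fun t => w * p ^ 2 / (q + t * p)) MeasureTheory.volume 0 T ∧
      ∫ t in (0 : ℝ)..T, w * p ^ 2 / (q + t * p)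
        = w * p * (Real.log (q + T * p) - Real.log q) := by
  rcases hq.eq_or_lt with h0 | h0
  · have h1 : w * p = 0 := h h0.symm
    have h2 : w * p ^ 2 = 0 := by rw [pow_two, ← mul_assoc, h1, zero_mul]
    simp [h1, h2]
  · have hpos : ∀ t ∈ Set.uIcc 0 T, 0 < q + t * p := fun t ht => by
      rw [Set.uIcc_of_le hT] at ht
      have := mul_nonneg ht.1 hp
      linarith
    have hint : IntervalIntegrable (fun t => w * p ^ 2 / (q + t * p)) MeasureTheory.volume 0 T := by
      refine ContinuousOn.intervalIntegrable ?_
      refine ContinuousOn.div (by fun_prop) (by fun_prop) fun t ht => (hpos t ht).ne'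
    refine ⟨hint, ?_⟩
    have hd : ∀ t ∈ Set.uIcc 0 T,
        HasDerivAt (fun t => w * p * Real.log (q + t * p)) (w * p ^ 2 / (q + t * p)) t := by
      intro t ht
      have h1 : HasDerivAt (fun t => q + t * p) p t := by
        simpa using ((hasDerivAt_id t).mul_const p).const_add q
      have h2 := (h1.log (hpos t ht).ne').const_mul (w * p)
      rwa [← mul_div_assoc, mul_assoc, ← pow_two] at h2
    rw [intervalIntegral.integral_eq_sub_of_hasDerivAt hd hint]
    simp [mul_sub]

/-- For nonzero weight, `log (q + T p) - log T = log (q / T + p)`, which tends to `log p`. -/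
theorem tendsto_log_term {w p q : ℝ} (hp : 0 ≤ p) (hq : 0 ≤ q) (h : q = 0 → w * p = 0) :
    Tendsto (fun T : ℝ => w * p * (Real.log (q + T * p) - Real.log q) - w * p * Real.log T) atTop
      (𝓝 (w * p * (Real.log p - Real.log q))) := by
  by_cases hwp : w * p = 0
  · simp [hwp]
  have hq' : 0 < q := hq.lt_of_ne fun h' => hwp (h h'.symm)
  have hp' : 0 < p := hp.lt_of_ne fun h' => hwp (by rw [← h', mul_zero])
  have h1 : Tendsto (fun T : ℝ => q / T + p) atTop (𝓝 (0 + p)) :=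
    (tendsto_const_nhds.div_atTop tendsto_id).add_const p
  rw [zero_add] at h1
  have h2 := ((h1.log hp'.ne').sub_const (Real.log q)).const_mul (w * p)
  refine h2.congr' ?_
  filter_upwards [eventually_gt_atTop 0] with T hT
  have h3 : q + T * p = T * (q / T + p) := by field_simp
  have h4 : 0 < q / T + p := add_pos (div_pos hq' hT) hp'
  rw [h3, Real.log_mul hT.ne' h4.ne']
  ring

theorem intervalIntegrable_resolventEntropy {ρ σ : Matrix ι ι ℂ} (hρ : ρ.PosSemidef)
    (hσ : σ.PosSemidef) (hd : Dominated ρ σ) {T : ℝ} (hT : 0 ≤ T) :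
    IntervalIntegrable (resolventEntropy ρ σ) MeasureTheory.volume 0 T := by
  obtain ⟨U, p, h⟩ := exists_isDiagonalization hρ.isHermitian
  obtain ⟨V, q, h'⟩ := exists_isDiagonalization hσ.isHermitian
  have hp := h.nonneg hρ
  have hq := h'.nonneg hσ
  have h0 := h.overlap_mul_eq_zero h' hp hd
  have := IntervalIntegrable.sum Finset.univ fun i _ =>
    IntervalIntegrable.sum Finset.univ fun j _ =>
      (intervalIntegrable_and_integral_eq (hp i) (hq j) (h0 i j) hT).1
  refine this.congr fun t ht => ?_
  rw [Set.uIoc_of_le hT] at ht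
  simp only [Finset.sum_apply]
  rw [h.resolventEntropy_eq h' hp hq ht.1]

/-- The divergent part depends on `ρ` only through its trace, so it cancels when arguments of
matching trace are compared. -/
theorem tendsto_integral_resolventEntropy {ρ σ : Matrix ι ι ℂ} (hρ : ρ.PosSemidef)
    (hσ : σ.PosSemidef) (hd : Dominated ρ σ) :
    Tendsto (fun T => (∫ t in (0 : ℝ)..T, resolventEntropy ρ σ t) - ρ.trace.re * Real.log T) atTop
      (𝓝 (umegaki ρ σ)) := by
  obtain ⟨U, p, h⟩ := exists_isDiagonalization hρ.isHermitian
  obtain ⟨V, q, h'⟩ := exists_isDiagonalization hσ.isHermitian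
  have hp := h.nonneg hρ
  have hq := h'.nonneg hσ
  have h0 := h.overlap_mul_eq_zero h' hp hd
  rw [h.umegaki_eq h']
  have h1 := tendsto_finsetSum Finset.univ fun i _ =>
    tendsto_finsetSum Finset.univ fun j _ => tendsto_log_term (hp i) (hq j) (h0 i j)
  refine h1.congr' ?_
  filter_upwards [eventually_ge_atTop 0] with T hT
  have h2 : ∫ t in (0 : ℝ)..T, resolventEntropy ρ σ t
      = ∑ i, ∑ j, overlap U V i j * p i * (Real.log (q j + T * p i) - Real.log (q j)) := by
    have : ∫ t in (0 : ℝ)..T, resolventEntropy ρ σ t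
        = ∫ t in (0 : ℝ)..T, ∑ i, ∑ j, overlap U V i j * p i ^ 2 / (q j + t * p i) := by
      refine intervalIntegral.integral_congr_ae (MeasureTheory.ae_of_all _ fun t ht => ?_)
      rw [Set.uIoc_of_le hT] at ht
      exact h.resolventEntropy_eq h' hp hq ht.1
    rw [this, intervalIntegral.integral_finsetSum]
    · refine Finset.sum_congr rfl fun i _ => ?_
      rw [intervalIntegral.integral_finsetSum]
      · exact Finset.sum_congr rfl fun j _ =>
          (intervalIntegrable_and_integral_eq (hp i) (hq j) (h0 i j) hT).2
      · exact fun j _ => (intervalIntegrable_and_integral_eq (hp i) (hq j) (h0 i j) hT).1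
    · intro i _
      have := IntervalIntegrable.sum Finset.univ fun j _ =>
        (intervalIntegrable_and_integral_eq (hp i) (hq j) (h0 i j) hT).1
      simpa only [← Finset.sum_fn] using! this
  have h3 : ρ.trace.re = ∑ i, ∑ j, overlap U V i j * p i := by
    rw [h.trace_eq]
    refine Finset.sum_congr rfl fun i _ => ?_
    rw [← Finset.sum_mul, sum_overlap h.unitary h'.unitary, one_mul]
  rw [h2, h3]
  simp only [Finset.sum_mul, ← Finset.sum_sub_distrib]

end Resolvent

/-! ### Completely positive trace-preserving maps -/

section CPTP

variable {ι κ : Type*} [Fintype ι] [DecidableEq ι] [Fintype κ] [DecidableEq κ]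

theorem exists_eq_star_mul_self_of_nonneg {A : Type*} [CStarAlgebra A] [PartialOrder A]
    [StarOrderedRing A] {a : A} (ha : 0 ≤ a) : ∃ b, a = star b * b :=
  CStarAlgebra.nonneg_iff_eq_star_mul_self.mp ha

open scoped Matrix.Norms.L2Operator MatrixOrder in
/-- Two-positivity of a completely positive map, on the Gram matrix of `B` and `B * Y`. -/
theorem IsCPTP.exists_gram {Λ : Matrix ι ι ℂ →ₗ[ℂ] Matrix κ κ ℂ} (hΛ : IsCPTP Λ)
    (B Y : Matrix ι ι ℂ) :
    ∃ C D : Fin 2 → Matrix κ κ ℂ,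
      Λ (Bᴴ * B) = ∑ c, (C c)ᴴ * C c ∧ Λ (Bᴴ * B * Y) = ∑ c, (C c)ᴴ * D c ∧
      Λ (Yᴴ * (Bᴴ * B)) = ∑ c, (D c)ᴴ * C c ∧ Λ (Yᴴ * (Bᴴ * B) * Y) = ∑ c, (D c)ᴴ * D c := by
  obtain ⟨⟨Φ, rfl⟩, -⟩ := hΛ
  -- With a zero second row, `star G * G` has exactly the four blocks built from `B` and `B * Y`.
  -- Its image is positive and is factored again; the columns of the factor are `C` and `D`.
  set G : CStarMatrix (Fin 2) (Fin 2) (Matrix ι ι ℂ) :=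
    CStarMatrix.ofMatrix (of ![![B, B * Y], ![0, 0]]) with hG
  have h1 : 0 ≤ (star G * G).map Φ.toLinearMap :=
    Φ.map_cstarMatrix_nonneg' 2 _ (star_mul_self_nonneg G)
  obtain ⟨C, hC⟩ := exists_eq_star_mul_self_of_nonneg
    (A := CStarMatrix (Fin 2) (Fin 2) (Matrix κ κ ℂ)) h1
  have h2 : ∀ a b, Φ.toLinearMap ((star G * G) a b) = ∑ c, (C c a)ᴴ * C c b := by
    intro a b
    have := congrFun (congrFun hC a) b
    rw [CStarMatrix.map_apply, CStarMatrix.mul_apply] at this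
    exact this
  have h3 : ∀ a b, (star G * G) a b = (G 0 a)ᴴ * G 0 b := by
    intro a b
    rw [CStarMatrix.mul_apply, Fin.sum_univ_two]
    have : G 1 b = 0 := by fin_cases b <;> rfl
    rw [this, mul_zero, add_zero]
    rfl
  have h0 : G 0 0 = B := rfl
  have h01 : G 0 1 = B * Y := rfl
  refine ⟨fun c => C c 0, fun c => C c 1, ?_, ?_, ?_, ?_⟩
  · rw [← h2, h3, h0]
  · rw [← h2, h3, h0, h01, Matrix.mul_assoc]
  · rw [← h2, h3, h0, h01, conjTranspose_mul, Matrix.mul_assoc]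
  · rw [← h2, h3, h01, conjTranspose_mul]
    simp only [Matrix.mul_assoc]

theorem IsCPTP.posSemidef {Λ : Matrix ι ι ℂ →ₗ[ℂ] Matrix κ κ ℂ} (hΛ : IsCPTP Λ)
    {σ : Matrix ι ι ℂ} (hσ : σ.PosSemidef) : (Λ σ).PosSemidef := by
  obtain ⟨B, rfl⟩ := exists_eq_conjTranspose_mul_self hσ
  obtain ⟨C, D, h, -⟩ := hΛ.exists_gram B 1
  rw [h]
  exact posSemidef_sum _ fun c _ => posSemidef_conjTranspose_mul_self _

theorem IsCPTP.map_conjTranspose {Λ : Matrix ι ι ℂ →ₗ[ℂ] Matrix κ κ ℂ} (hΛ : IsCPTP Λ)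
    (Y : Matrix ι ι ℂ) : Λ Yᴴ = (Λ Y)ᴴ := by
  obtain ⟨C, D, -, h1, h2, -⟩ := hΛ.exists_gram 1 Y
  simp only [conjTranspose_one, Matrix.one_mul, Matrix.mul_one] at h1 h2
  rw [h1, h2, conjTranspose_sum]
  exact Finset.sum_congr rfl fun c _ => by simp

theorem IsCPTP.mem_states {Λ : Matrix ι ι ℂ →ₗ[ℂ] Matrix κ κ ℂ} (hΛ : IsCPTP Λ)
    {σ : Matrix ι ι ℂ} (hσ : σ ∈ states ι) : Λ σ ∈ states κ :=
  ⟨hΛ.posSemidef hσ.1, (hΛ.2 σ).trans hσ.2⟩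

/-- The adjoint of a linear map for the bilinear trace form. -/
theorem exists_trace_adjoint (Λ : Matrix ι ι ℂ →ₗ[ℂ] Matrix κ κ ℂ) (X : Matrix κ κ ℂ) :
    ∃ Y : Matrix ι ι ℂ, ∀ A, (Λ A * X).trace = (A * Y).trace := by
  refine ⟨of fun j i => (Λ (single i j 1) * X).trace, fun A => ?_⟩
  conv_lhs => rw [matrix_eq_sum_single A]
  simp only [map_sum, Finset.sum_mul, trace_sum]
  rw [trace]
  refine Finset.sum_congr rfl fun i _ => ?_
  rw [diag_apply, mul_apply]
  refine Finset.sum_congr rfl fun j _ => ?_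
  have : single i j (A i j) = A i j • single i j (1 : ℂ) := by simp
  rw [this, map_smul, Matrix.smul_mul, trace_smul, of_apply, smul_eq_mul]

/-- Kadison's inequality for the adjoint of a channel. -/
theorem IsCPTP.re_trace_mul_le {Λ : Matrix ι ι ℂ →ₗ[ℂ] Matrix κ κ ℂ} (hΛ : IsCPTP Λ)
    {X : Matrix κ κ ℂ} {Y : Matrix ι ι ℂ} (hY : ∀ A, (Λ A * X).trace = (A * Y).trace)
    (hY' : ∀ A, (Λ A * Xᴴ).trace = (A * Yᴴ).trace)
    {σ : Matrix ι ι ℂ} (hσ : σ.PosSemidef) :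
    (σ * (Y * Yᴴ)).trace.re ≤ (Λ σ * (X * Xᴴ)).trace.re := by
  obtain ⟨B, rfl⟩ := exists_eq_conjTranspose_mul_self hσ
  obtain ⟨C, D, h1, h2, h3, h4⟩ := hΛ.exists_gram B Y
  -- Expanding the square, the two cross terms and the `D`-`D` term each have trace `Tr σ Y Yᴴ` up
  -- to sign, the latter by trace preservation; one negative copy survives.
  have h5 : 0 ≤ (∑ c, (C c * X - D c)ᴴ * (C c * X - D c)).trace.re :=
    re_trace_nonneg (posSemidef_sum _ fun c _ => posSemidef_conjTranspose_mul_self _)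
  have h6 : ∑ c, (C c * X - D c)ᴴ * (C c * X - D c)
      = Xᴴ * Λ (Bᴴ * B) * X - Xᴴ * Λ (Bᴴ * B * Y) - Λ (Yᴴ * (Bᴴ * B)) * X
        + Λ (Yᴴ * (Bᴴ * B) * Y) := by
    rw [h1, h2, h3, h4]
    simp only [Finset.mul_sum, Finset.sum_mul, ← Finset.sum_sub_distrib, ← Finset.sum_add_distrib]
    refine Finset.sum_congr rfl fun c _ => ?_
    rw [conjTranspose_sub, conjTranspose_mul]
    simp only [Matrix.sub_mul, Matrix.mul_sub, Matrix.mul_assoc]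
    abel
  rw [h6, trace_add, trace_sub, trace_sub, hΛ.2, hY, Matrix.mul_assoc, trace_mul_comm Xᴴ,
    trace_mul_comm Xᴴ, hY'] at h5
  have h7 : (Yᴴ * (Bᴴ * B) * Y).trace = (Bᴴ * B * (Y * Yᴴ)).trace := by
    rw [Matrix.mul_assoc, trace_mul_comm]
    simp only [Matrix.mul_assoc]
  have h8 : (Λ (Bᴴ * B) * X * Xᴴ).trace = (Λ (Bᴴ * B) * (X * Xᴴ)).trace := by
    rw [Matrix.mul_assoc]
  have h9 : (Bᴴ * B * Y * Yᴴ).trace = (Bᴴ * B * (Y * Yᴴ)).trace := by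
    rw [Matrix.mul_assoc _ Y]
  rw [h7, h8, h9] at h5
  simp only [Complex.add_re, Complex.sub_re] at h5
  linarith

/-- Pulling a test operator `X` back to `Y` through the adjoint of `Λ` keeps the linear term and, by
Kadison's inequality, does not increase either subtracted quadratic term. -/
theorem IsCPTP.resolventEntropy_le {Λ : Matrix ι ι ℂ →ₗ[ℂ] Matrix κ κ ℂ} (hΛ : IsCPTP Λ)
    {ρ σ : Matrix ι ι ℂ} (hρ : ρ.PosSemidef) (hσ : σ.PosSemidef) {t : ℝ} (ht : 0 < t) :
    resolventEntropy (Λ ρ) (Λ σ) t ≤ resolventEntropy ρ σ t := by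
  refine QRT.resolventEntropy_le (hΛ.posSemidef hρ) (hΛ.posSemidef hσ) ht fun X => ?_
  obtain ⟨Y, hY⟩ := exists_trace_adjoint Λ X
  have hY' : ∀ A, (Λ A * Xᴴ).trace = (A * Yᴴ).trace := by
    intro A
    have := congrArg star (hY Aᴴ)
    rw [← trace_conjTranspose, ← trace_conjTranspose, conjTranspose_mul, conjTranspose_mul,
      hΛ.map_conjTranspose, conjTranspose_conjTranspose, conjTranspose_conjTranspose,
      trace_mul_comm, trace_mul_comm Yᴴ] at this
    exact this
  refine le_trans ?_ (resolventForm_le_resolventEntropy hρ hσ ht Y)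
  have h1 := hΛ.re_trace_mul_le hY hY' hσ
  have h2 := hΛ.re_trace_mul_le (X := Xᴴ) (Y := Yᴴ) hY' (by simpa using hY) hρ
  rw [conjTranspose_conjTranspose, conjTranspose_conjTranspose] at h2
  rw [resolventForm, resolventForm, hY]
  have h3 := mul_le_mul_of_nonneg_left h2 ht.le
  linarith

theorem Dominated.map {Λ : Matrix ι ι ℂ →ₗ[ℂ] Matrix κ κ ℂ} (hΛ : IsCPTP Λ)
    {ρ σ : Matrix ι ι ℂ} (h : Dominated ρ σ) : Dominated (Λ ρ) (Λ σ) := by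
  obtain ⟨c, hc⟩ := h
  refine ⟨c, ?_⟩
  have := hΛ.posSemidef hc
  rwa [map_sub, LinearMap.map_smul_of_tower] at this

end CPTP

/-! ### Properties of the relative entropy -/

section Properties

variable {ι κ : Type*} [Fintype ι] [DecidableEq ι] [Fintype κ] [DecidableEq κ]

theorem umegaki_le_add {ρ σ : Matrix κ κ ℂ} {ρ₁ σ₁ ρ₂ σ₂ : Matrix ι ι ℂ} {a b : ℝ}
    (hρ : ρ.PosSemidef) (hσ : σ.PosSemidef) (hd : Dominated ρ σ)
    (hρ₁ : ρ₁.PosSemidef) (hσ₁ : σ₁.PosSemidef) (hd₁ : Dominated ρ₁ σ₁)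
    (hρ₂ : ρ₂.PosSemidef) (hσ₂ : σ₂.PosSemidef) (hd₂ : Dominated ρ₂ σ₂)
    (htr : ρ.trace.re = a * ρ₁.trace.re + b * ρ₂.trace.re)
    (h : ∀ t > 0, resolventEntropy ρ σ t
      ≤ a * resolventEntropy ρ₁ σ₁ t + b * resolventEntropy ρ₂ σ₂ t) :
    umegaki ρ σ ≤ a * umegaki ρ₁ σ₁ + b * umegaki ρ₂ σ₂ := by
  have h1 := tendsto_integral_resolventEntropy hρ hσ hd
  have h2 := ((tendsto_integral_resolventEntropy hρ₁ hσ₁ hd₁).const_mul a).add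
    ((tendsto_integral_resolventEntropy hρ₂ hσ₂ hd₂).const_mul b)
  refine le_of_tendsto_of_tendsto h1 h2 ?_
  filter_upwards [eventually_ge_atTop 0] with T hT
  have i1 := (intervalIntegrable_resolventEntropy hρ₁ hσ₁ hd₁ hT).const_mul a
  have i2 := (intervalIntegrable_resolventEntropy hρ₂ hσ₂ hd₂ hT).const_mul b
  have h3 := intervalIntegral.integral_mono_on_of_le_Ioo hT
    (intervalIntegrable_resolventEntropy hρ hσ hd hT) (i1.add i2) fun t ht => h t ht.1
  rw [intervalIntegral.integral_add i1 i2, intervalIntegral.integral_const_mul,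
    intervalIntegral.integral_const_mul] at h3
  rw [htr]
  linarith

theorem umegaki_le_umegaki {ρ σ : Matrix κ κ ℂ} {ρ₁ σ₁ : Matrix ι ι ℂ}
    (hρ : ρ.PosSemidef) (hσ : σ.PosSemidef) (hd : Dominated ρ σ)
    (hρ₁ : ρ₁.PosSemidef) (hσ₁ : σ₁.PosSemidef) (hd₁ : Dominated ρ₁ σ₁)
    (htr : ρ.trace.re = ρ₁.trace.re)
    (h : ∀ t > 0, resolventEntropy ρ σ t ≤ resolventEntropy ρ₁ σ₁ t) :
    umegaki ρ σ ≤ umegaki ρ₁ σ₁ := by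
  have := umegaki_le_add (a := 1) (b := 0) hρ hσ hd hρ₁ hσ₁ hd₁ hρ₁ hσ₁ hd₁
    (by linarith) (fun t ht => by linarith [h t ht])
  linarith

/-- The data-processing inequality. -/
theorem IsCPTP.umegaki_le {Λ : Matrix ι ι ℂ →ₗ[ℂ] Matrix κ κ ℂ} (hΛ : IsCPTP Λ)
    {ρ σ : Matrix ι ι ℂ} (hρ : ρ.PosSemidef) (hσ : σ.PosSemidef) (hd : Dominated ρ σ) :
    umegaki (Λ ρ) (Λ σ) ≤ umegaki ρ σ :=
  umegaki_le_umegaki (hΛ.posSemidef hρ) (hΛ.posSemidef hσ) (hd.map hΛ) hρ hσ hd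
    (by rw [hΛ.2]) fun _ ht => hΛ.resolventEntropy_le hρ hσ ht

theorem re_trace_mul_mul_conjTranspose_nonneg {A : Matrix ι ι ℂ} (hA : A.PosSemidef)
    (X : Matrix ι ι ℂ) : 0 ≤ (A * (X * Xᴴ)).trace.re := by
  have h := re_trace_nonneg (hA.conjTranspose_mul_mul_same X)
  rwa [Matrix.mul_assoc, trace_mul_comm, Matrix.mul_assoc] at h

theorem Dominated.exists_nonneg {ρ σ : Matrix ι ι ℂ} (hσ : σ.PosSemidef) (h : Dominated ρ σ) :
    ∃ c : ℝ, 0 ≤ c ∧ (c • σ - ρ).PosSemidef := by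
  obtain ⟨c, hc⟩ := h
  refine ⟨max c 0, le_max_right _ _, ?_⟩
  have := hc.add (PosSemidef.real_smul hσ (c := max c 0 - c) (sub_nonneg.mpr (le_max_left _ _)))
  convert this using 1
  module

theorem Dominated.mono_right {ρ σ τ : Matrix ι ι ℂ} (hσ : σ.PosSemidef) (h : Dominated ρ σ)
    (hτ : (τ - σ).PosSemidef) : Dominated ρ τ := by
  obtain ⟨c, hc, h⟩ := h.exists_nonneg hσ
  refine ⟨c, ?_⟩
  convert h.add (PosSemidef.real_smul hτ hc) using 1
  module

theorem Dominated.refl (ρ : Matrix ι ι ℂ) : Dominated ρ ρ :=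
  ⟨1, by simpa using PosSemidef.zero⟩

theorem Dominated.smul_right {ρ σ : Matrix ι ι ℂ} (h : Dominated ρ σ) {c : ℝ} (hc : c ≠ 0) :
    Dominated ρ (c • σ) := by
  obtain ⟨d, hd⟩ := h
  exact ⟨d * c⁻¹, by rwa [smul_smul, inv_mul_cancel_right₀ hc]⟩

theorem Dominated.combo {ρ₁ σ₁ ρ₂ σ₂ : Matrix ι ι ℂ} (hσ₁ : σ₁.PosSemidef) (hσ₂ : σ₂.PosSemidef)
    (h₁ : Dominated ρ₁ σ₁) (h₂ : Dominated ρ₂ σ₂) {a b : ℝ} (ha : 0 ≤ a) (hb : 0 ≤ b) :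
    Dominated (a • ρ₁ + b • ρ₂) (a • σ₁ + b • σ₂) := by
  obtain ⟨c, hc, h₁⟩ := h₁.exists_nonneg hσ₁
  obtain ⟨d, hd, h₂⟩ := h₂.exists_nonneg hσ₂
  refine ⟨c + d, ?_⟩
  have := ((PosSemidef.real_smul h₁ ha).add (PosSemidef.real_smul h₂ hb)).add
    ((PosSemidef.real_smul hσ₁ (mul_nonneg ha hd)).add
      (PosSemidef.real_smul hσ₂ (mul_nonneg hb hc)))
  convert this using 1
  module

/-- At fixed `X`, the second argument enters `resolventForm` with a negative sign. -/
theorem umegaki_anti_right {ρ σ τ : Matrix ι ι ℂ} (hρ : ρ.PosSemidef) (hσ : σ.PosSemidef)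
    (hd : Dominated ρ σ) (hτ : (τ - σ).PosSemidef) : umegaki ρ τ ≤ umegaki ρ σ := by
  have hτ' : τ.PosSemidef := by simpa using hτ.add hσ
  refine umegaki_le_umegaki hρ hτ' (hd.mono_right hσ hτ) hρ hσ hd rfl fun t ht => ?_
  refine resolventEntropy_le hρ hτ' ht fun X => ?_
  refine le_trans ?_ (resolventForm_le_resolventEntropy hρ hσ ht X)
  have := re_trace_mul_mul_conjTranspose_nonneg hτ X
  rw [Matrix.sub_mul, trace_sub, Complex.sub_re] at this
  rw [resolventForm, resolventForm]
  linarith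

/-- Joint convexity, in unnormalized form. -/
theorem umegaki_combo_le {ρ₁ σ₁ ρ₂ σ₂ : Matrix ι ι ℂ} (hρ₁ : ρ₁.PosSemidef) (hσ₁ : σ₁.PosSemidef)
    (h₁ : Dominated ρ₁ σ₁) (hρ₂ : ρ₂.PosSemidef) (hσ₂ : σ₂.PosSemidef) (h₂ : Dominated ρ₂ σ₂)
    {a b : ℝ} (ha : 0 ≤ a) (hb : 0 ≤ b) :
    umegaki (a • ρ₁ + b • ρ₂) (a • σ₁ + b • σ₂) ≤ a * umegaki ρ₁ σ₁ + b * umegaki ρ₂ σ₂ := by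
  have hρ := (PosSemidef.real_smul hρ₁ ha).add (PosSemidef.real_smul hρ₂ hb)
  have hσ := (PosSemidef.real_smul hσ₁ ha).add (PosSemidef.real_smul hσ₂ hb)
  refine umegaki_le_add hρ hσ (h₁.combo hσ₁ hσ₂ h₂ ha hb) hρ₁ hσ₁ h₁ hρ₂ hσ₂ h₂ (by simp)
    fun t ht => resolventEntropy_le hρ hσ ht fun X => ?_
  have i₁ := mul_le_mul_of_nonneg_left (resolventForm_le_resolventEntropy hρ₁ hσ₁ ht X) ha
  have i₂ := mul_le_mul_of_nonneg_left (resolventForm_le_resolventEntropy hρ₂ hσ₂ ht X) hb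
  -- The form is linear in `(ρ, σ)` at fixed `X`, so its maximum over `X` is jointly convex.
  refine le_trans (le_of_eq ?_) (add_le_add i₁ i₂)
  simp only [resolventForm, Matrix.add_mul, Matrix.smul_mul, trace_add, trace_smul,
    Complex.add_re, Complex.real_smul, Complex.re_ofReal_mul]
  ring

theorem umegaki_self (ρ : Matrix ι ι ℂ) : umegaki ρ ρ = 0 := by
  simp [umegaki]

theorem IsDiagonalization.smul {U A : Matrix ι ι ℂ} {p : ι → ℝ} (h : IsDiagonalization U p A)
    (c : ℝ) : IsDiagonalization U (fun i => c * p i) (c • A) where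
  unitary := h.unitary
  eq := by
    have : diagonal (fun i => ((c * p i : ℝ) : ℂ)) = c • diagonal (fun i => (p i : ℂ)) := by
      ext i j
      by_cases hij : i = j
      · subst hij; simp
      · simp [hij]
    conv_lhs => rw [h.eq]
    rw [this, Matrix.mul_smul, Matrix.smul_mul]

theorem umegaki_smul_right {ρ σ : Matrix ι ι ℂ} (hρ : ρ.PosSemidef) (hσ : σ.PosSemidef)
    (hd : Dominated ρ σ) {c : ℝ} (hc : 0 < c) :
    umegaki ρ (c • σ) = umegaki ρ σ - ρ.trace.re * Real.log c := by
  obtain ⟨U, p, h⟩ := exists_isDiagonalization hρ.isHermitian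
  obtain ⟨V, q, h'⟩ := exists_isDiagonalization hσ.isHermitian
  have h0 := h.overlap_mul_eq_zero h' (h.nonneg hρ) hd
  have h3 : ρ.trace.re = ∑ i, ∑ j, overlap U V i j * p i := by
    rw [h.trace_eq]
    refine Finset.sum_congr rfl fun i _ => ?_
    rw [← Finset.sum_mul, sum_overlap h.unitary h'.unitary, one_mul]
  rw [h.umegaki_eq (h'.smul c), h.umegaki_eq h', h3]
  simp only [Finset.sum_mul, ← Finset.sum_sub_distrib]
  refine Finset.sum_congr rfl fun i _ => Finset.sum_congr rfl fun j _ => ?_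
  by_cases hj : q j = 0
  · simp [h0 i j hj]
  · rw [Real.log_mul hc.ne' hj]
    ring

/-- Termwise this is `x (log x - log y) ≥ x - y`, from `log z ≥ 1 - 1 / z`. -/
theorem IsDiagonalization.sub_le_umegaki {U V ρ σ : Matrix ι ι ℂ} {p q : ι → ℝ}
    (h : IsDiagonalization U p ρ) (h' : IsDiagonalization V q σ) (hp : ∀ i, 0 ≤ p i)
    (hq : ∀ i, 0 ≤ q i) (hd : Dominated ρ σ) :
    ∑ i, ∑ j, (overlap U V i j * p i - overlap U V i j * q j) ≤ umegaki ρ σ := by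
  rw [h.umegaki_eq h']
  refine Finset.sum_le_sum fun i _ => Finset.sum_le_sum fun j _ => ?_
  have hw := overlap_nonneg U V i j
  by_cases hwp : overlap U V i j * p i = 0
  · have := mul_nonneg hw (hq j)
    rw [hwp]
    linarith
  have hj : 0 < q j :=
    (hq j).lt_of_ne fun hj => hwp (h.overlap_mul_eq_zero h' hp hd i j hj.symm)
  have hi : 0 < p i := (hp i).lt_of_ne fun hi => hwp (by rw [← hi, mul_zero])
  have h1 := Real.one_sub_inv_le_log_of_pos (div_pos hi hj)
  rw [Real.log_div hi.ne' hj.ne', inv_div] at h1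
  have h2 := mul_le_mul_of_nonneg_left h1 (mul_nonneg hw hi.le)
  refine le_trans (le_of_eq ?_) h2
  field_simp

/-- Klein's inequality. -/
theorem umegaki_nonneg {ρ σ : Matrix ι ι ℂ} (hρ : ρ ∈ states ι) (hσ : σ ∈ states ι)
    (hd : Dominated ρ σ) : 0 ≤ umegaki ρ σ := by
  obtain ⟨U, p, h⟩ := exists_isDiagonalization hρ.1.isHermitian
  obtain ⟨V, q, h'⟩ := exists_isDiagonalization hσ.1.isHermitian
  refine le_trans (le_of_eq ?_) (h.sub_le_umegaki h' (h.nonneg hρ.1) (h'.nonneg hσ.1) hd)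
  have h1 : ∑ i, ∑ j, overlap U V i j * p i = 1 := by
    simp only [← Finset.sum_mul, sum_overlap h.unitary h'.unitary, one_mul]
    rw [← h.trace_eq, hρ.2, Complex.one_re]
  have h2 : ∑ i, ∑ j, overlap U V i j * q j = 1 := by
    rw [Finset.sum_comm]
    simp only [overlap_symm U V, ← Finset.sum_mul, sum_overlap h'.unitary h.unitary, one_mul]
    rw [← h'.trace_eq, hσ.2, Complex.one_re]
  simp only [Finset.sum_sub_distrib, h1, h2, sub_self]

/-- Donald's identity bounds the concavity defect of the relative entropy. -/
theorem le_umegaki_combo {ρ₁ ρ₂ σ : Matrix ι ι ℂ} (hρ₁ : ρ₁ ∈ states ι) (hρ₂ : ρ₂ ∈ states ι)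
    {a b : ℝ} (ha : 0 < a) (hb : 0 < b) :
    a * umegaki ρ₁ σ + b * umegaki ρ₂ σ + (a * Real.log a + b * Real.log b)
      ≤ umegaki (a • ρ₁ + b • ρ₂) σ := by
  set Ω := a • ρ₁ + b • ρ₂ with hΩ
  -- The defect is the average of `D(ρᵢ‖Ω)`, as the `log σ` terms cancel by linearity. Each of these
  -- is at most `-log` of its weight because `Ω` contains that multiple of `ρᵢ`.
  have key : ∀ {ρ : Matrix ι ι ℂ} {c : ℝ}, ρ ∈ states ι → 0 < c → (Ω - c • ρ).PosSemidef →
      umegaki ρ Ω ≤ - Real.log c := by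
    intro ρ c hρ hc h
    have := umegaki_anti_right hρ.1 (PosSemidef.real_smul hρ.1 hc.le)
      ((Dominated.refl ρ).smul_right hc.ne') h
    rw [umegaki_smul_right hρ.1 hρ.1 (Dominated.refl ρ) hc, umegaki_self, hρ.2, Complex.one_re] at this
    linarith
  have k₁ := key hρ₁ ha (by simpa [hΩ] using PosSemidef.real_smul hρ₂.1 hb.le)
  have k₂ := key hρ₂ hb (by simpa [hΩ] using PosSemidef.real_smul hρ₁.1 ha.le)
  have k₁' := mul_le_mul_of_nonneg_left k₁ ha.le
  have k₂' := mul_le_mul_of_nonneg_left k₂ hb.le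
  have e : ∀ S : Matrix ι ι ℂ, (Ω * S).trace.re
      = a * (ρ₁ * S).trace.re + b * (ρ₂ * S).trace.re := by
    intro S
    simp [hΩ, Matrix.add_mul]
  rw [umegaki_eq_sub] at k₁' k₂'
  rw [umegaki_eq_sub, umegaki_eq_sub, umegaki_eq_sub, e, e]
  linarith

end Properties

/-! ### Tensor products -/

section Tensor

variable {ι κ : Type*} [Fintype ι] [DecidableEq ι] [Fintype κ] [DecidableEq κ]

theorem posSemidef_kronecker {X : Matrix ι ι ℂ} {Y : Matrix κ κ ℂ} (hX : X.PosSemidef)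
    (hY : Y.PosSemidef) : (X ⊗ₖ Y).PosSemidef :=
  hX.kronecker hY

theorem Dominated.kronecker {ρ σ : Matrix ι ι ℂ} {ρ' σ' : Matrix κ κ ℂ} (hρ : ρ.PosSemidef)
    (hσ : σ.PosSemidef) (hσ' : σ'.PosSemidef)
    (h : Dominated ρ σ) (h' : Dominated ρ' σ') : Dominated (ρ ⊗ₖ ρ') (σ ⊗ₖ σ') := by
  obtain ⟨c, hc, h⟩ := h.exists_nonneg hσ
  obtain ⟨d, hd, h'⟩ := h'.exists_nonneg hσ'
  refine ⟨c * d, ?_⟩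
  -- `cσ ⊗ dσ' - ρ ⊗ ρ' = (cσ - ρ) ⊗ dσ' + ρ ⊗ (dσ' - ρ')`.
  convert (posSemidef_kronecker h (PosSemidef.real_smul hσ' hd)).add (posSemidef_kronecker hρ h') using 1
  ext x y
  simp only [Matrix.sub_apply, Matrix.smul_apply, Matrix.add_apply, kroneckerMap_apply, Complex.real_smul,
    Complex.ofReal_mul]
  ring

theorem overlap_kronecker (U V : Matrix ι ι ℂ) (U' V' : Matrix κ κ ℂ) (x y : ι × κ) :
    overlap (U ⊗ₖ U') (V ⊗ₖ V') x y = overlap U V x.1 y.1 * overlap U' V' x.2 y.2 := by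
  rw [overlap, conjTranspose_kronecker, ← mul_kronecker_mul, kroneckerMap_apply, Complex.normSq_mul,
    overlap, overlap]

theorem umegaki_kronecker {ρ σ : Matrix ι ι ℂ} {ρ' σ' : Matrix κ κ ℂ} (hρ : ρ ∈ states ι)
    (hσ : σ.PosSemidef) (hρ' : ρ' ∈ states κ) (hσ' : σ'.PosSemidef)
    (hd : Dominated ρ σ) (hd' : Dominated ρ' σ') :
    umegaki (ρ ⊗ₖ ρ') (σ ⊗ₖ σ') = umegaki ρ σ + umegaki ρ' σ' := by
  obtain ⟨U, p, h⟩ := exists_isDiagonalization hρ.1.isHermitian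
  obtain ⟨V, q, k⟩ := exists_isDiagonalization hσ.isHermitian
  obtain ⟨U', p', h'⟩ := exists_isDiagonalization hρ'.1.isHermitian
  obtain ⟨V', q', k'⟩ := exists_isDiagonalization hσ'.isHermitian
  have h1 : ∑ i, ∑ j, overlap U V i j * p i = 1 := by
    simp only [← Finset.sum_mul, sum_overlap h.unitary k.unitary, one_mul]
    rw [← h.trace_eq, hρ.2, Complex.one_re]
  have h2 : ∑ i, ∑ j, overlap U' V' i j * p' i = 1 := by
    simp only [← Finset.sum_mul, sum_overlap h'.unitary k'.unitary, one_mul]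
    rw [← h'.trace_eq, hρ'.2, Complex.one_re]
  rw [(h.kronecker h').umegaki_eq (k.kronecker k')]
  -- The logarithms of products split wherever the weight is nonzero; elsewhere both sides vanish.
  -- Summing then uses that the weights of each factor add up to one.
  have h3 : ∀ i i' j j', overlap (U ⊗ₖ U') (V ⊗ₖ V') (i, i') (j, j') * (p i * p' i')
        * (Real.log (p i * p' i') - Real.log (q j * q' j'))
      = (overlap U V i j * p i * (Real.log (p i) - Real.log (q j)))
          * (overlap U' V' i' j' * p' i')
        + (overlap U V i j * p i)
          * (overlap U' V' i' j' * p' i' * (Real.log (p' i') - Real.log (q' j'))) := by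
    intro i i' j j'
    rw [overlap_kronecker]
    by_cases h4 : overlap U V i j * p i = 0
    · have : overlap U V i j * overlap U' V' i' j' * (p i * p' i')
          = (overlap U V i j * p i) * (overlap U' V' i' j' * p' i') := by ring
      simp [this, h4]
    by_cases h5 : overlap U' V' i' j' * p' i' = 0
    · have : overlap U V i j * overlap U' V' i' j' * (p i * p' i')
          = (overlap U V i j * p i) * (overlap U' V' i' j' * p' i') := by ring
      simp [this, h5]
    rw [Real.log_mul (right_ne_zero_of_mul h4) (right_ne_zero_of_mul h5),
      Real.log_mul (fun hj => h4 (h.overlap_mul_eq_zero k (h.nonneg hρ.1) hd i j hj))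
        (fun hj => h5 (h'.overlap_mul_eq_zero k' (h'.nonneg hρ'.1) hd' i' j' hj))]
    ring
  have h6 : ∀ f g : ι → ι → ℝ, ∀ f' g' : κ → κ → ℝ,
      ∑ x : ι × κ, ∑ y : ι × κ, (f x.1 y.1 * f' x.2 y.2 + g x.1 y.1 * g' x.2 y.2)
        = (∑ i, ∑ j, f i j) * (∑ i, ∑ j, f' i j) + (∑ i, ∑ j, g i j) * (∑ i, ∑ j, g' i j) := by
    intro f g f' g'
    simp only [Fintype.sum_prod_type, Finset.sum_add_distrib, Finset.sum_mul_sum]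
  have h7 := h6 (fun i j => overlap U V i j * p i * (Real.log (p i) - Real.log (q j)))
    (fun i j => overlap U V i j * p i) (fun i j => overlap U' V' i j * p' i)
    (fun i j => overlap U' V' i j * p' i * (Real.log (p' i) - Real.log (q' j)))
  rw [h1, h2, mul_one, one_mul, ← h.umegaki_eq k, ← h'.umegaki_eq k'] at h7
  rw [← h7]
  exact Finset.sum_congr rfl fun x _ => Finset.sum_congr rfl fun y _ => h3 _ _ _ _

theorem umegaki_reindex {ρ σ : Matrix ι ι ℂ} (hρ : ρ.PosSemidef) (hσ : σ.PosSemidef) (e : ι ≃ κ) :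
    umegaki (ρ.reindex e e) (σ.reindex e e) = umegaki ρ σ := by
  obtain ⟨U, p, h⟩ := exists_isDiagonalization hρ.isHermitian
  obtain ⟨V, q, k⟩ := exists_isDiagonalization hσ.isHermitian
  rw [(h.reindex e).umegaki_eq (k.reindex e), h.umegaki_eq k]
  refine Fintype.sum_equiv e.symm _ _ fun i => Fintype.sum_equiv e.symm _ _ fun j => ?_
  have : overlap (U.reindex e e) (V.reindex e e) i j = overlap U V (e.symm i) (e.symm j) := by
    simp only [overlap, reindex_apply, conjTranspose_submatrix, submatrix_mul_equiv,
      submatrix_apply]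
  rw [this]

theorem posSemidef_reindex {A : Matrix ι ι ℂ} (hA : A.PosSemidef) (e : ι ≃ κ) :
    (A.reindex e e).PosSemidef :=
  hA.submatrix _

theorem trace_reindex (A : Matrix ι ι ℂ) (e : ι ≃ κ) : (A.reindex e e).trace = A.trace :=
  Fintype.sum_equiv e.symm _ _ fun _ => rfl

theorem Dominated.reindex {ρ σ : Matrix ι ι ℂ} (h : Dominated ρ σ) (e : ι ≃ κ) :
    Dominated (ρ.reindex e e) (σ.reindex e e) := by
  obtain ⟨c, hc⟩ := h
  exact ⟨c, posSemidef_reindex hc e⟩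

theorem reindex_mem_states {ρ : Matrix ι ι ℂ} (hρ : ρ ∈ states ι) (e : ι ≃ κ) :
    ρ.reindex e e ∈ states κ :=
  ⟨posSemidef_reindex hρ.1 e, by rw [trace_reindex, hρ.2]⟩

theorem kronecker_mem_states {ρ : Matrix ι ι ℂ} {ρ' : Matrix κ κ ℂ} (hρ : ρ ∈ states ι)
    (hρ' : ρ' ∈ states κ) : ρ ⊗ₖ ρ' ∈ states (ι × κ) :=
  ⟨hρ.1.kronecker hρ'.1, by rw [trace_kronecker, hρ.2, hρ'.2, one_mul]⟩

variable {A : Type*} [Fintype A] [DecidableEq A] {n m : ℕ}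

theorem tensor_mem_states {X : Op A n} {Y : Op A m} (hX : X ∈ states (Fin n → A))
    (hY : Y ∈ states (Fin m → A)) : tensor X Y ∈ states (Fin (n + m) → A) :=
  reindex_mem_states (kronecker_mem_states hX hY) _

theorem Dominated.tensor {ρ σ : Op A n} {ρ' σ' : Op A m} (hρ : ρ.PosSemidef)
    (hσ : σ.PosSemidef) (hσ' : σ'.PosSemidef)
    (h : Dominated ρ σ) (h' : Dominated ρ' σ') : Dominated (tensor ρ ρ') (tensor σ σ') :=
  (h.kronecker hρ hσ hσ' h').reindex _

theorem umegaki_tensor {ρ σ : Op A n} {ρ' σ' : Op A m} (hρ : ρ ∈ states (Fin n → A))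
    (hσ : σ.PosSemidef) (hρ' : ρ' ∈ states (Fin m → A)) (hσ' : σ'.PosSemidef)
    (hd : Dominated ρ σ) (hd' : Dominated ρ' σ') :
    umegaki (tensor ρ ρ') (tensor σ σ') = umegaki ρ σ + umegaki ρ' σ' := by
  rw [tensor, tensor, umegaki_reindex (hρ.1.kronecker hρ'.1) (hσ.kronecker hσ'),
    umegaki_kronecker hρ hσ hρ' hσ' hd hd']

theorem tensorPow_add (ρ : Matrix A A ℂ) (n m : ℕ) :
    tensorPow ρ (n + m) = tensor (tensorPow ρ n) (tensorPow ρ m) := by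
  ext i j
  simp only [tensor, tensorPow, reindex_apply, submatrix_apply, kroneckerMap_apply, of_apply,
    Fin.prod_univ_add]
  rfl

theorem tensorPow_zero (ρ : Matrix A A ℂ) : tensorPow ρ 0 = 1 := by
  ext i j
  rw [Subsingleton.elim i j]
  simp [tensorPow]

theorem tensorPow_one (ρ : Matrix A A ℂ) :
    tensorPow ρ 1 = ρ.reindex (Equiv.funUnique (Fin 1) A).symm (Equiv.funUnique (Fin 1) A).symm := by
  ext i j
  simp [tensorPow]

theorem tensorPow_mem_states {ρ : Matrix A A ℂ} (hρ : ρ ∈ states A) (n : ℕ) :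
    tensorPow ρ n ∈ states (Fin n → A) := by
  induction n with
  | zero =>
    rw [tensorPow_zero]
    exact ⟨PosSemidef.one, by simp⟩
  | succ n ih =>
    rw [tensorPow_add]
    refine tensor_mem_states ih ?_
    rw [tensorPow_one]
    exact reindex_mem_states hρ _

theorem tensorPow_sub_posSemidef {σ : Matrix A A ℂ} {c : ℝ} (hc : 0 ≤ c)
    (h : (σ - c • (1 : Matrix A A ℂ)).PosSemidef) (n : ℕ) :
    (tensorPow σ n - (c ^ n) • (1 : Op A n)).PosSemidef := by
  induction n with
  | zero => simpa [tensorPow_zero] using PosSemidef.zero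
  | succ n ih =>
    have h1 : (tensorPow σ 1 - c • (1 : Op A 1)).PosSemidef := by
      convert posSemidef_reindex h (Equiv.funUnique (Fin 1) A).symm using 1
      rw [tensorPow_one]
      simp only [reindex_apply]
      rw [← submatrix_one_equiv (Equiv.funUnique (Fin 1) A).symm.symm]
      rfl
    have hn : (tensorPow σ n).PosSemidef := by
      simpa using ih.add (PosSemidef.real_smul PosSemidef.one (pow_nonneg hc n))
    -- `σ^{⊗n} ⊗ σ - cⁿ⁺¹ = σ^{⊗n} ⊗ (σ - c) + (σ^{⊗n} - cⁿ) ⊗ c`.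
    have h2 := posSemidef_reindex ((posSemidef_kronecker hn h1).add
      (posSemidef_kronecker ih (PosSemidef.real_smul PosSemidef.one hc))) (Fin.appendEquiv (α := A) n 1)
    convert h2 using 1
    rw [tensorPow_add, tensor]
    have : (1 : Op A (n + 1)) = ((1 : Op A n) ⊗ₖ (1 : Op A 1)).reindex
        (Fin.appendEquiv n 1) (Fin.appendEquiv n 1) := by
      rw [one_kronecker_one, reindex_apply, submatrix_one_equiv]
    rw [this]
    ext x y
    simp only [Matrix.sub_apply, Matrix.smul_apply, Matrix.add_apply, reindex_apply, submatrix_apply,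
      kroneckerMap_apply, Complex.real_smul]
    push_cast
    ring

end Tensor

/-! ### Full-rank lower bounds and the Jordan decomposition -/

section Bounds

variable {ι κ : Type*} [Fintype ι] [DecidableEq ι] [Fintype κ] [DecidableEq κ]

theorem exists_smul_one_le_of_posDef {σ : Matrix ι ι ℂ} (hσ : σ.PosDef) :
    ∃ c : ℝ, 0 < c ∧ c ≤ 1 ∧ (σ - c • (1 : Matrix ι ι ℂ)).PosSemidef := by
  have h1 : Dominated (1 : Matrix ι ι ℂ) σ := by
    rw [← range_le_range_iff_dominated PosSemidef.one hσ.posSemidef]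
    rintro v -
    refine ⟨σ⁻¹ *ᵥ v, ?_⟩
    rw [mulVecLin_apply, mulVec_mulVec,
      mul_nonsing_inv _ ((isUnit_iff_isUnit_det _).mp hσ.isUnit), one_mulVec]
  obtain ⟨c, hc, h⟩ := h1.exists_nonneg hσ.posSemidef
  have hc' : 0 < c + 1 := by linarith
  refine ⟨(c + 1)⁻¹, inv_pos.mpr hc', inv_le_one_of_one_le₀ (by linarith), ?_⟩
  have := PosSemidef.real_smul (h.add hσ.posSemidef) (inv_pos.mpr hc').le
  convert this using 1
  have : c • σ - 1 + σ = (c + 1) • σ - 1 := by module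
  rw [this, smul_sub, smul_smul, inv_mul_cancel₀ hc'.ne', one_smul]

theorem sub_smul_posSemidef {σ ρ : Matrix ι ι ℂ} {c : ℝ} (hc : 0 ≤ c)
    (h : (σ - c • (1 : Matrix ι ι ℂ)).PosSemidef) (hρ : ρ ∈ states ι) :
    (σ - c • ρ).PosSemidef := by
  have h1 := posSemidef_trace_smul_one_sub hρ.1
  rw [hρ.2, Complex.one_re, one_smul] at h1
  convert h.add (PosSemidef.real_smul h1 hc) using 1
  module

theorem dominated_of_smul_one_le {σ ρ : Matrix ι ι ℂ} {c : ℝ} (hc : 0 < c)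
    (h : (σ - c • (1 : Matrix ι ι ℂ)).PosSemidef) (hρ : ρ ∈ states ι) : Dominated ρ σ :=
  ((Dominated.refl ρ).smul_right hc.ne').mono_right (PosSemidef.real_smul hρ.1 hc.le)
    (sub_smul_posSemidef hc.le h hρ)

/-- The bound by the max-relative entropy: replace `σ` by the smaller `c • ρ`. -/
theorem umegaki_le_neg_log {σ ρ : Matrix ι ι ℂ} {c : ℝ} (hc : 0 < c)
    (h : (σ - c • ρ).PosSemidef) (hρ : ρ ∈ states ι) : umegaki ρ σ ≤ - Real.log c := by
  have := umegaki_anti_right hρ.1 (PosSemidef.real_smul hρ.1 hc.le)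
    ((Dominated.refl ρ).smul_right hc.ne') h
  rw [umegaki_smul_right hρ.1 hρ.1 (Dominated.refl ρ) hc, umegaki_self, hρ.2, Complex.one_re] at this
  linarith

/-- The Jordan decomposition of a Hermitian matrix, with a trace-norm bound. -/
theorem exists_posPart_negPart {X : Matrix ι ι ℂ} (hX : X.IsHermitian) :
    ∃ P N : Matrix ι ι ℂ, P.PosSemidef ∧ N.PosSemidef ∧ X = P - N ∧
      P.trace.re ≤ traceNorm X := by
  obtain ⟨U, x, h⟩ := exists_isDiagonalization hX
  have hP : IsDiagonalization U (fun i => max (x i) 0)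
      (U * diagonal (fun i => ((max (x i) 0 : ℝ) : ℂ)) * Uᴴ) := ⟨h.unitary, rfl⟩
  have hN : IsDiagonalization U (fun i => max (-x i) 0)
      (U * diagonal (fun i => ((max (-x i) 0 : ℝ) : ℂ)) * Uᴴ) := ⟨h.unitary, rfl⟩
  refine ⟨_, _, hP.posSemidef fun i => le_max_right _ _, hN.posSemidef fun i => le_max_right _ _,
    ?_, ?_⟩
  · rw [← Matrix.sub_mul, ← Matrix.mul_sub, diagonal_sub]
    conv_lhs => rw [h.eq]
    congr! 3
    ext i
    rw [← Complex.ofReal_sub]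
    congr 1
    rcases le_total (x i) 0 with hi | hi
    · rw [max_eq_right hi, max_eq_left (by linarith)]; ring
    · rw [max_eq_left hi, max_eq_right (by linarith)]; ring
  · have hsq : IsDiagonalization U (fun i => x i * x i) (Xᴴ * X) :=
      { unitary := h.unitary
        eq := by
          rw [hX.eq]
          conv_lhs => rw [h.eq]
          calc _ = U * diagonal (fun i => (x i : ℂ)) * (Uᴴ * U) * diagonal (fun i => (x i : ℂ))
                * Uᴴ := by simp only [Matrix.mul_assoc]
            _ = _ := by
              rw [h.unitary, Matrix.mul_one, Matrix.mul_assoc U, diagonal_mul_diagonal]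
              simp }
    have habs : IsDiagonalization U (fun i => Real.sqrt (x i * x i)) (cfc Real.sqrt (Xᴴ * X)) :=
      ⟨h.unitary, hsq.cfc_eq _⟩
    rw [traceNorm, habs.trace_eq, hP.trace_eq]
    refine Finset.sum_le_sum fun i _ => ?_
    rw [Real.sqrt_mul_self_eq_abs]
    exact max_le (le_abs_self _) (abs_nonneg _)

end Bounds

/-! ### The relative entropy of resource -/

section Resource

variable {ι κ : Type*} [Fintype ι] [DecidableEq ι] [Fintype κ] [DecidableEq κ]

/-- The relative entropy of resource, as a real number. -/
def resourceDiv (F : Set (Matrix ι ι ℂ)) (ρ : Matrix ι ι ℂ) : ℝ :=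
  sInf {r | ∃ σ ∈ F, Dominated ρ σ ∧ r = umegaki ρ σ}

theorem resourceDiv_le {F : Set (Matrix ι ι ℂ)} (hF : F ⊆ states ι) {ρ σ : Matrix ι ι ℂ}
    (hρ : ρ ∈ states ι) (hσ : σ ∈ F) (hd : Dominated ρ σ) : resourceDiv F ρ ≤ umegaki ρ σ := by
  refine csInf_le ⟨0, ?_⟩ ⟨σ, hσ, hd, rfl⟩
  rintro _ ⟨τ, hτ, hd', rfl⟩
  exact umegaki_nonneg hρ (hF hτ) hd'

/-- A dominating free state must exist, since the real `sInf ∅` is `0`. -/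
theorem le_resourceDiv {F : Set (Matrix ι ι ℂ)} {ρ : Matrix ι ι ℂ} {b : ℝ}
    (hne : ∃ σ ∈ F, Dominated ρ σ) (h : ∀ σ ∈ F, Dominated ρ σ → b ≤ umegaki ρ σ) :
    b ≤ resourceDiv F ρ := by
  obtain ⟨σ, hσ, hd⟩ := hne
  refine le_csInf ⟨_, σ, hσ, hd, rfl⟩ ?_
  rintro _ ⟨τ, hτ, hd', rfl⟩
  exact h τ hτ hd'

theorem resourceDiv_nonneg {F : Set (Matrix ι ι ℂ)} (hF : F ⊆ states ι) {ρ : Matrix ι ι ℂ}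
    (hρ : ρ ∈ states ι) (hne : ∃ σ ∈ F, Dominated ρ σ) : 0 ≤ resourceDiv F ρ :=
  le_resourceDiv hne fun _ hσ hd => umegaki_nonneg hρ (hF hσ) hd

theorem relEntropyOfResource_eq {F : Set (Matrix ι ι ℂ)} (hF : F ⊆ states ι) {ρ : Matrix ι ι ℂ}
    (hρ : ρ ∈ states ι) (hne : ∃ σ ∈ F, Dominated ρ σ) :
    relEntropyOfResource F ρ = (resourceDiv F ρ : EReal) := by
  have hle : ∀ σ ∈ F, Dominated ρ σ → relEntropyOfResource F ρ ≤ (umegaki ρ σ : EReal) := by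
    intro σ hσ hd
    rw [← relEntropy_of_dominated hρ.1 (hF hσ).1 hd]
    exact iInf₂_le σ hσ
  refine le_antisymm ?_ ?_
  · generalize relEntropyOfResource F ρ = m at hle
    induction m with
    | bot => exact bot_le
    | top =>
      obtain ⟨σ, hσ, hd⟩ := hne
      exact absurd (hle σ hσ hd) (by simp)
    | coe x =>
      exact EReal.coe_le_coe_iff.mpr
        (le_resourceDiv hne fun σ hσ hd => EReal.coe_le_coe_iff.mp (hle σ hσ hd))
  · refine le_iInf₂ fun σ hσ => ?_
    by_cases hd : Dominated ρ σ
    · rw [relEntropy_of_dominated hρ.1 (hF hσ).1 hd]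
      exact EReal.coe_le_coe_iff.mpr (resourceDiv_le hF hρ hσ hd)
    · rw [relEntropy_of_not_dominated hρ.1 (hF hσ).1 hd]
      exact le_top

theorem neg_one_le_entropy_term {a b : ℝ} (ha : 0 < a) (hb : 0 < b) (hab : a + b = 1) :
    -1 ≤ a * Real.log a + b * Real.log b := by
  have key : ∀ x : ℝ, 0 < x → x - 1 ≤ x * Real.log x := by
    intro x hx
    have := mul_le_mul_of_nonneg_left (Real.one_sub_inv_le_log_of_pos hx) hx.le
    rwa [mul_sub, mul_one, mul_inv_cancel₀ hx.ne'] at this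
  linarith [key a ha, key b hb]

/-- Asymptotic continuity of the relative entropy of resource. -/
theorem resourceDiv_le_add {F : Set (Matrix ι ι ℂ)} (hF : F ⊆ states ι) (hconv : Convex ℝ F)
    {σ₀ : Matrix ι ι ℂ} (hσ₀ : σ₀ ∈ F) {c : ℝ} (hc : 0 < c) (hc1 : c ≤ 1)
    (h₀ : (σ₀ - c • (1 : Matrix ι ι ℂ)).PosSemidef) {ρ τ : Matrix ι ι ℂ} (hρ : ρ ∈ states ι)
    (hτ : τ ∈ states ι) {ε : ℝ} (hε : traceNorm (τ - ρ) ≤ ε) :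
    resourceDiv F ρ ≤ resourceDiv F τ + ε * (- Real.log c) + (1 + ε) := by
  obtain ⟨P, N, hP, hN, hX, hPX⟩ :=
    exists_posPart_negPart (hτ.1.isHermitian.sub hρ.1.isHermitian)
  set e := P.trace.re with he
  have hlog : 0 ≤ - Real.log c := neg_nonneg.mpr (Real.log_nonpos hc.le hc1)
  have hcompl : ∀ {Q : Matrix ι ι ℂ}, Q.PosSemidef → Q.trace = (Q.trace.re : ℂ) := fun hQ =>
    Complex.ext rfl (by simpa using (Complex.le_def.mp hQ.trace_nonneg).2.symm)
  have htr : N.trace = P.trace := by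
    have := congrArg trace hX
    rw [trace_sub, trace_sub, hτ.2, hρ.2, sub_self] at this
    exact (sub_eq_zero.mp this.symm).symm
  have he0 : 0 ≤ e := re_trace_nonneg hP
  have hee : e ≤ ε := hPX.trans hε
  have hmono : resourceDiv F τ + e * (- Real.log c) + (1 + e)
      ≤ resourceDiv F τ + ε * (- Real.log c) + (1 + ε) := by
    have := mul_le_mul_of_nonneg_right hee hlog
    linarith
  refine le_trans ?_ hmono
  -- The case `e = 0`, where `τ = ρ`, is separated because `P` and `N` are normalised by `e` below.
  rcases he0.eq_or_lt with h0 | h0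
  · have hP0 := eq_zero_of_re_trace_nonpos hP h0.ge
    have hN0 := eq_zero_of_re_trace_nonpos hN (by rw [htr]; exact h0.ge)
    rw [hP0, hN0, sub_zero, sub_eq_zero] at hX
    rw [← h0, hX]
    linarith
  have hnorm : ∀ {Q : Matrix ι ι ℂ}, Q.PosSemidef → Q.trace = P.trace → e⁻¹ • Q ∈ states ι := by
    intro Q hQ hQP
    refine ⟨PosSemidef.real_smul hQ (inv_nonneg.mpr he0), ?_⟩
    rw [trace_smul, hQP, hcompl hP, ← he, Complex.real_smul, ← Complex.ofReal_mul,
      inv_mul_cancel₀ h0.ne', Complex.ofReal_one]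
  have hΔ := hnorm hP rfl
  have hΔ' := hnorm hN htr
  -- The Alicki–Fannes–Winter argument: `τ - ρ = P - N` means `ρ + P = τ + N`, so after division by
  -- `1 + e` one state is a mixture of `ρ` with `e⁻¹ • P` and also of `τ` with `e⁻¹ • N`.
  set a := (1 + e)⁻¹ with ha
  set b := e * (1 + e)⁻¹ with hb
  have h1e : 0 < 1 + e := by linarith
  have ha0 : 0 < a := inv_pos.mpr h1e
  have hb0 : 0 < b := mul_pos h0 ha0
  have hab : a + b = 1 := by rw [ha, hb]; field_simp
  have hΩ : a • ρ + b • (e⁻¹ • P) = a • τ + b • (e⁻¹ • N) := by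
    have hbe : b * e⁻¹ = a := by rw [hb, ha]; field_simp
    rw [smul_smul, smul_smul, hbe, ← smul_add, ← smul_add]
    congr 1
    rw [sub_eq_sub_iff_add_eq_add] at hX
    rw [hX, add_comm]
  suffices ∀ σ ∈ F, Dominated τ σ →
      resourceDiv F ρ ≤ umegaki τ σ + e * (- Real.log c) + (1 + e) by
    have h2 : resourceDiv F ρ - e * (- Real.log c) - (1 + e) ≤ resourceDiv F τ :=
      le_resourceDiv ⟨σ₀, hσ₀, dominated_of_smul_one_le hc h₀ hτ⟩ fun σ hσ hd => by
        linarith [this σ hσ hd]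
    linarith
  intro σ hσ hd
  -- Mixing in `σ₀` keeps the candidate free and makes it dominate every state. Relative to it,
  -- joint convexity bounds the common mixture above via `τ`, and `le_umegaki_combo` bounds it below
  -- via `ρ`.
  have hσ'' : a • σ + b • σ₀ ∈ F := hconv hσ hσ₀ ha0.le hb0.le hab
  have hdom : ∀ {θ : Matrix ι ι ℂ}, θ ∈ states ι → Dominated θ (a • σ + b • σ₀) := fun hθ =>
    ((dominated_of_smul_one_le hc h₀ hθ).smul_right hb0.ne').mono_right
      (PosSemidef.real_smul (hF hσ₀).1 hb0.le)
      (by simpa using PosSemidef.real_smul (hF hσ).1 ha0.le)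
  have h3 := umegaki_combo_le hτ.1 (hF hσ).1 hd hΔ'.1 (hF hσ₀).1
    (dominated_of_smul_one_le hc h₀ hΔ') ha0.le hb0.le
  have h4 := le_umegaki_combo (σ := a • σ + b • σ₀) hρ hΔ ha0 hb0
  rw [hΩ] at h4
  have h5 := mul_le_mul_of_nonneg_left
    (umegaki_le_neg_log hc (sub_smul_posSemidef hc.le h₀ hΔ') hΔ') hb0.le
  have h6 := mul_nonneg hb0.le (umegaki_nonneg hΔ (hF hσ'') (hdom hΔ))
  have h7 := neg_one_le_entropy_term ha0 hb0 hab
  have h8 : a * umegaki ρ (a • σ + b • σ₀) ≤ a * umegaki τ σ + b * (- Real.log c) + 1 := by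
    linarith
  have h9 := mul_le_mul_of_nonneg_left h8 h1e.le
  have h10 : (1 + e) * (a * umegaki ρ (a • σ + b • σ₀)) = umegaki ρ (a • σ + b • σ₀) := by
    rw [ha, mul_inv_cancel_left₀ h1e.ne']
  have h11 : (1 + e) * (a * umegaki τ σ + b * (- Real.log c) + 1)
      = umegaki τ σ + e * (- Real.log c) + (1 + e) := by
    rw [ha, hb]
    field_simp
  rw [h10, h11] at h9
  exact (resourceDiv_le hF hρ hσ'' (hdom hρ)).trans h9

/-- Approximately resource-non-generating operations increase the relative entropy of resource by
at most a constant. -/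
theorem resourceDiv_map_le {F : Set (Matrix ι ι ℂ)} {F' : Set (Matrix κ κ ℂ)}
    (hF : F ⊆ states ι) (hF' : F' ⊆ states κ) {δ : ℝ≥0} (hδ : δ ≤ 1)
    {Λ : Matrix ι ι ℂ →ₗ[ℂ] Matrix κ κ ℂ} (hΛ : Λ ∈ RNG F F' δ) {ρ : Matrix ι ι ℂ}
    (hρ : ρ ∈ states ι) (hne : ∃ σ ∈ F, Dominated ρ σ) :
    resourceDiv F' (Λ ρ) ≤ resourceDiv F ρ + 2 := by
  suffices resourceDiv F' (Λ ρ) - 2 ≤ resourceDiv F ρ by linarith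
  refine le_resourceDiv hne fun σ hσ hd => ?_
  -- The strict bound yields an admissible `s < 2` without the infimum being attained; then `log (1
  -- + s) ≤ s < 2`.
  have h1 : robustness F' (Λ σ) < 2 :=
    (hΛ.2 σ hσ).trans_lt (lt_of_le_of_lt (ENNReal.coe_le_coe.mpr hδ) (by norm_num))
  simp only [robustness, iInf_lt_iff] at h1
  obtain ⟨s, ⟨τ, hτ, hs⟩, hs2⟩ := h1
  have hs2' : (s : ℝ) < 2 := by exact_mod_cast hs2
  have hs0 : (0 : ℝ) ≤ s := s.coe_nonneg
  have h1s : (0 : ℝ) < 1 + s := by linarith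
  set σ' := (1 + (s : ℝ))⁻¹ • (Λ σ + (s : ℝ) • τ) with hσ'
  have h2 : (1 + (s : ℝ)) • σ' = Λ σ + (s : ℝ) • τ := by
    rw [hσ', smul_smul, mul_inv_cancel₀ h1s.ne', one_smul]
  have hΛρ := hΛ.1.mem_states hρ
  have hΛσ := hΛ.1.posSemidef (hF hσ).1
  have hle : ((1 + (s : ℝ)) • σ' - Λ σ).PosSemidef := by
    rw [h2, add_sub_cancel_left]
    exact PosSemidef.real_smul hτ.1 hs0
  have hd1 := hd.map hΛ.1
  have hd2 := hd1.mono_right hΛσ hle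
  have hd3 : Dominated (Λ ρ) σ' := by
    have := hd2.smul_right (inv_ne_zero h1s.ne')
    rwa [smul_smul, inv_mul_cancel₀ h1s.ne', one_smul] at this
  have h3 := umegaki_anti_right hΛρ.1 hΛσ hd1 hle
  rw [umegaki_smul_right hΛρ.1 (hF' hs).1 hd3 h1s, hΛρ.2, Complex.one_re] at h3
  have h4 := hΛ.1.umegaki_le hρ.1 (hF hσ).1 hd
  have h5 := Real.log_le_sub_one_of_pos h1s
  have h6 := resourceDiv_le hF' hΛρ hs hd3
  linarith

end Resource

/-! ### Families of free states -/

section Families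

variable {A B : Type*} [Fintype A] [DecidableEq A] [Fintype B] [DecidableEq B]
  {M : ∀ n : ℕ, Set (Op A n)} {M' : ∀ n : ℕ, Set (Op B n)}

/-- The full-rank state of Axiom 2 may vary with `n`; tensoring the one for `n = 1` gives a single
`σ`, hence one constant `c`, for all `n`. -/
theorem IsFreeFamily.tensorPow_mem (hM : IsFreeFamily M) {σ : Matrix A A ℂ}
    (h : tensorPow σ 1 ∈ M 1) (n : ℕ) : tensorPow σ n ∈ M n := by
  induction n with
  | zero =>
    obtain ⟨τ, -, -, hτ⟩ := hM.exists_fullRank 0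
    rwa [tensorPow_zero] at hτ ⊢
  | succ n ih =>
    rw [tensorPow_add]
    exact hM.tensor_mem n 1 _ ih _ h

/-- A free family contains full-rank states with exponentially decaying smallest eigenvalue. -/
theorem IsFreeFamily.exists_smul_one_le (hM : IsFreeFamily M) :
    ∃ c : ℝ, 0 < c ∧ c ≤ 1 ∧ ∀ n, ∃ σ ∈ M n, (σ - (c ^ n) • (1 : Op A n)).PosSemidef := by
  obtain ⟨σ, -, hσ, hσM⟩ := hM.exists_fullRank 1
  obtain ⟨c, hc, hc1, h⟩ := exists_smul_one_le_of_posDef hσ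
  exact ⟨c, hc, hc1, fun n => ⟨_, hM.tensorPow_mem hσM n, tensorPow_sub_posSemidef hc.le h n⟩⟩

theorem IsFreeFamily.exists_dominated (hM : IsFreeFamily M) {n : ℕ} {ρ : Op A n}
    (hρ : ρ ∈ states (Fin n → A)) : ∃ σ ∈ M n, Dominated ρ σ := by
  obtain ⟨c, hc, -, h⟩ := hM.exists_smul_one_le
  obtain ⟨σ, hσ, hσc⟩ := h n
  exact ⟨σ, hσ, dominated_of_smul_one_le (pow_pos hc n) hσc hρ⟩

theorem IsFreeFamily.resourceDiv_nonneg (hM : IsFreeFamily M) {n : ℕ} {ρ : Op A n}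
    (hρ : ρ ∈ states (Fin n → A)) : 0 ≤ resourceDiv (M n) ρ :=
  QRT.resourceDiv_nonneg (hM.subset_states n) hρ (hM.exists_dominated hρ)

/-- Products of free candidates are free by Axiom 4, and the relative entropy is additive on them.
-/
theorem IsFreeFamily.subadditive (hM : IsFreeFamily M) {ρ : Matrix A A ℂ} (hρ : ρ ∈ states A) :
    Subadditive fun n => resourceDiv (M n) (tensorPow ρ n) := by
  intro m n
  have hm := tensorPow_mem_states hρ m
  have hn := tensorPow_mem_states hρ n
  suffices resourceDiv (M (m + n)) (tensorPow ρ (m + n)) - resourceDiv (M n) (tensorPow ρ n)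
      ≤ resourceDiv (M m) (tensorPow ρ m) by linarith
  refine le_resourceDiv (hM.exists_dominated hm) fun σ hσ hd => ?_
  suffices resourceDiv (M (m + n)) (tensorPow ρ (m + n)) - umegaki (tensorPow ρ m) σ
      ≤ resourceDiv (M n) (tensorPow ρ n) by linarith
  refine le_resourceDiv (hM.exists_dominated hn) fun τ hτ hd' => ?_
  have hσ' := (hM.subset_states m hσ).1
  have hτ' := (hM.subset_states n hτ).1
  have h1 := resourceDiv_le (hM.subset_states _) (tensorPow_mem_states hρ (m + n))
    (hM.tensor_mem m n _ hσ _ hτ) (tensorPow_add ρ m n ▸ hd.tensor hm.1 hσ' hτ' hd')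
  rw [tensorPow_add, umegaki_tensor hm hσ' hn hτ' hd hd'] at h1
  rw [tensorPow_add]
  linarith

theorem IsFreeFamily.bddBelow (hM : IsFreeFamily M) {ρ : Matrix A A ℂ} (hρ : ρ ∈ states A) :
    BddBelow (Set.range fun n : ℕ => resourceDiv (M n) (tensorPow ρ n) / n) := by
  refine ⟨0, ?_⟩
  rintro _ ⟨n, rfl⟩
  exact div_nonneg (hM.resourceDiv_nonneg (tensorPow_mem_states hρ n)) n.cast_nonneg

/-- The regularised relative entropy of resource is a finite limit, and a lower bound of the
sequence that it regularises. -/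
theorem IsFreeFamily.exists_regRelEntropy (hM : IsFreeFamily M) {ρ : Matrix A A ℂ}
    (hρ : ρ ∈ states A) : ∃ L : ℝ, regRelEntropy M ρ = L ∧
      Tendsto (fun n : ℕ => resourceDiv (M n) (tensorPow ρ n) / n) atTop (𝓝 L) ∧
      (∀ n : ℕ, n * L ≤ resourceDiv (M n) (tensorPow ρ n)) := by
  have hsub := hM.subadditive hρ
  have hbdd := hM.bddBelow hρ
  have hlim := hsub.tendsto_lim hbdd
  refine ⟨hsub.lim, ?_, hlim, fun n => ?_⟩
  · refine Tendsto.limUnder_eq ?_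
    refine ((continuous_coe_real_ereal.tendsto _).comp hlim).congr fun n => ?_
    have hn := tensorPow_mem_states hρ n
    rw [Function.comp_apply, relEntropyOfResource_eq (hM.subset_states n) hn
      (hM.exists_dominated hn), EReal.coe_div]
    rfl
  -- By Fekete's lemma the limit is the infimum over `n ≥ 1`; at `n = 0` only nonnegativity is
  -- needed.
  · rcases Nat.eq_zero_or_pos n with rfl | hn
    · simpa using hM.resourceDiv_nonneg (tensorPow_mem_states hρ 0)
    · have := hsub.lim_le_div hbdd hn.ne'
      rw [le_div_iff₀ (by exact_mod_cast hn)] at this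
      linarith

/-- Continuity contributes `1 + ε ≤ 2` and the robustness another `2`, whence the `4`. -/
theorem IsFreeFamily.resourceDiv_le_of_conversionError_lt (hM : IsFreeFamily M)
    (hM' : IsFreeFamily M') {ρ : Matrix A A ℂ} (hρ : ρ ∈ states A) {ω : Matrix B B ℂ}
    (hω : ω ∈ states B) {c : ℝ} (hc : 0 < c) (hc1 : c ≤ 1)
    (hc' : ∀ n, ∃ σ ∈ M' n, (σ - (c ^ n) • (1 : Op B n)).PosSemidef)
    {n k : ℕ} {δ : ℝ≥0} (hδ : δ ≤ 1) {ε : ℝ} (hε : ε ≤ 1)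
    (h : conversionError M M' ρ ω n k δ < ENNReal.ofReal ε) :
    resourceDiv (M' k) (tensorPow ω k)
      ≤ resourceDiv (M n) (tensorPow ρ n) + 4 + k * (ε * (- Real.log c)) := by
  simp only [conversionError, iInf_lt_iff] at h
  obtain ⟨Λ, hΛ, hlt⟩ := h
  have htr : traceNorm (Λ (tensorPow ρ n) - tensorPow ω k) ≤ ε :=
    (lt_imp_lt_of_le_imp_le ENNReal.ofReal_le_ofReal hlt).le
  have hn := tensorPow_mem_states hρ n
  obtain ⟨σ₀, hσ₀, h₀⟩ := hc' k
  have h1 := resourceDiv_le_add (hM'.subset_states k) (hM'.convex k) hσ₀ (pow_pos hc k)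
    (pow_le_one₀ hc.le hc1) h₀ (tensorPow_mem_states hω k) (hΛ.1.mem_states hn) htr
  have h2 := resourceDiv_map_le (hM.subset_states n) (hM'.subset_states k) hδ hΛ hn
    (hM.exists_dominated hn)
  rw [Real.log_pow] at h1
  linarith

end Families

end QRT

end

/-! ### The bound on the transformation rate -/

theorem mainTheorem4 {A B : Type*} [Fintype A] [DecidableEq A] [Fintype B] [DecidableEq B]
    (M : ∀ n : ℕ, Set (QRT.Op A n)) (M' : ∀ n : ℕ, Set (QRT.Op B n))
    (hM : QRT.IsFreeFamily M) (hM' : QRT.IsFreeFamily M')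
    (ρ : Matrix A A ℂ) (hρ : ρ ∈ QRT.states A) (ω : Matrix B B ℂ) (hω : ω ∈ QRT.states B)
    (hpos : 0 < QRT.regRelEntropy M' ω) :
    QRT.rateARNG M M' ρ ω ≤ QRT.regRelEntropy M ρ / QRT.regRelEntropy M' ω := by
  obtain ⟨L, hL, hLlim, -⟩ := hM.exists_regRelEntropy hρ
  obtain ⟨L', hL', -, hL'le⟩ := hM'.exists_regRelEntropy hω
  obtain ⟨c, hc, hc1, hc'⟩ := hM'.exists_smul_one_le
  rw [hL'] at hpos
  have hL'0 : 0 < L' := EReal.coe_pos.mp hpos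
  have hL0 : 0 ≤ L := ge_of_tendsto hLlim (Eventually.of_forall fun n =>
    div_nonneg (hM.resourceDiv_nonneg (QRT.tensorPow_mem_states hρ n)) n.cast_nonneg)
  rw [hL, hL', ← EReal.coe_div]
  refine sSup_le ?_
  rintro _ ⟨k, δ, herr, hδ, rfl⟩
  by_contra hlt
  obtain ⟨r, hr1, hr2⟩ := EReal.lt_iff_exists_real_btwn.mp (not_le.mp hlt)
  have hr : L / L' < r := EReal.coe_lt_coe_iff.mp hr1
  have hr0 : 0 ≤ r := (div_nonneg hL0 hL'0.le).trans hr.le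
  have hk := eventually_lt_of_lt_liminf hr2
  -- Since `r < k n / n` eventually, dividing the one-shot bound by `n` and letting `n → ∞` gives
  -- this for fixed `ε`. The sign condition allows `k n / n` to be replaced by `r`; it holds for
  -- small `ε` because `L' > 0`.
  have key : ∀ ε : ℝ, 0 < ε → ε ≤ 1 → 0 ≤ L' - ε * (-Real.log c) →
      r * (L' - ε * (-Real.log c)) ≤ L := by
    intro ε hε hε1 hpos'
    have h4 : Tendsto (fun n : ℕ => QRT.resourceDiv (M n) (QRT.tensorPow ρ n) / n + 4 / (n : ℝ))
        atTop (𝓝 (L + 0)) := hLlim.add (tendsto_const_div_atTop_nhds_zero_nat 4)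
    rw [add_zero] at h4
    refine ge_of_tendsto h4 ?_
    filter_upwards [hk, herr.eventually_lt_const (ENNReal.ofReal_pos.mpr hε),
      hδ.eventually_le_const zero_lt_one, eventually_gt_atTop 0] with n h1 h2 h3 hn
    have hn' : (0 : ℝ) < n := by exact_mod_cast hn
    have h5 : r < (k n : ℝ) / n := EReal.coe_lt_coe_iff.mp h1
    have h6 := hM.resourceDiv_le_of_conversionError_lt hM' hρ hω hc hc1 hc' h3 hε1 h2
    have h7 := hL'le (k n)
    have h8 := mul_le_mul_of_nonneg_right h5.le hpos'
    refine h8.trans ?_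
    rw [← add_div, div_mul_eq_mul_div, div_le_div_iff_of_pos_right hn']
    linarith
  have hlim : Tendsto (fun ε : ℝ => L' - ε * (-Real.log c)) (𝓝[>] 0) (𝓝 L') := by
    have : Tendsto (fun ε : ℝ => L' - ε * (-Real.log c)) (𝓝 0) (𝓝 (L' - 0 * (-Real.log c))) :=
      (Continuous.tendsto (by fun_prop) 0)
    rw [zero_mul, sub_zero] at this
    exact this.mono_left nhdsWithin_le_nhds
  have hfin : r * L' ≤ L := by
    refine le_of_tendsto (hlim.const_mul r) ?_
    filter_upwards [hlim.eventually_const_le hL'0, Ioc_mem_nhdsGT zero_lt_one] with ε h1 h2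
    exact key ε h2.1 h2.2 h1
  rw [div_lt_iff₀ hL'0] at hr
  linarith
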